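/- For every $n\ge 1$ let $(X_i,Y_i)=(X_{n,i},Y_{n,i})$, $i=1,\dots,n$, be independent (not necessarily identically distributed) random pairs on a probability space (which may depend on $n$), with $X_i$ in a measurable space $\mathcal X=\mathcal X_n$ and $Y_i\in\mathbb R$. Let $\psi_1,\dots,\psi_p$, with $p=p_n\ge 2$, be given measurable functions on $\mathcal X$ and $f_\beta:=\sum_{j=1}^p\beta_j\psi_j$, $\beta\in\mathbb R^p$. For random variables $Z=(Z_1,\dots,Z_n)$ write $\|Z\|_n^2:=\frac1n\sum_{i=1}^n Z_i^2$ and $\|Z\|^2:=\frac1n\sum_{i=1}^n\mathbb E Z_i^2$; for a function $f$ on $\mathcal X$, $\|f\|$ denotes $\|Z\|$ with $Z_i=f(X_i)$, $\mathbf Y-f$ stands for $Z_i=Y_i-f(X_i)$, and in norms of data-dependent functions the expectation in $\|\cdot\|$ is taken with the function held fixed. Let $\hat f$ be a least squares fit, i.e. any element of $\{f_\beta:\beta\in\mathbb R^p\}$ minimizing $\sum_{i=1}^n(Y_i-f_\beta(X_i))^2$. Let $f^0(X_i):=\mathbb E(Y_i\mid X_i)$, and let $f^*$ be the $L_2(P)$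 projection of $f^0$ on $\{f_\beta\}$, i.e. the minimizer of $\|f^0-f_\beta\|^2=\frac1n\sum_{i=1}^n\mathbb E\big(\mathbb E(Y_i\mid X_i)-f_\beta(X_i)\big)^2$ (it is not assumed that $f^0$ is of the form $f_\beta$). Assume that for every $n\ge1$: - $\max_{1\le i\le n}\|Y_i\|_{\Psi_2}\le K_0<\infty$, where $\|Z\|_{\Psi_2}:=\inf\{L>0:\ \mathbb E\exp(|Z/L|^2)-1<1\}$; - $\max_{i,j}|\psi_j(X_i)|\le K_X$ almost surely; - $\Lambda_{\min}>0$, where $\Lambda_{\min}^2$ is the smallest eigenvalue of the matrix $\Sigma=\big(\frac1n\sum_{i=1}^n\mathbb E\,\psi_j(X_i)\psi_k(X_i)\big)_{j,k}$. Here $K_0=K_{0,n}$, $K_X=K_{X,n}$ and $\Lambda_{\min}=\Lambda_{\min,n}$ may depend on $n$. Put $$\delta_n:=\sqrt{\frac{K_X^2(1+K_0^2)\,p\log p}{n\Lambda_{\min}^2}}$$ and assume $\delta_n\to0$ as $n\to\infty$. Then $$\|\hat f-f^*\|=\mathcal O_{\mathbb P}(\delta_n).$$ If moreover $K_0$ is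 bounded in $n$ (in particular, if $K_0$ is a constant not depending on $n$), then also $$\Big|\,\|\mathbf Y-\hat f\|_n^2-\|\mathbf Y-f^*\|^2\Big|=\mathcal O_{\mathbb P}(\delta_n).$$ Here $Z_n=\mathcal O_{\mathbb P}(r_n)$ means: for every $\varepsilon>0$ there is $C>0$ such that $\mathbb P(|Z_n|>Cr_n)\le\varepsilon$ for all sufficiently large $n$. -/

import Mathlib

open MeasureTheory ProbabilityTheory Filter Topology
open scoped NNReal ENNReal

namespace LeastSquares

noncomputable section

/-- `f_β = ∑ j, β_j ψ_j`. -/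
def linFun {𝒳 : Type*} {p : ℕ} (ψ : Fin p → 𝒳 → ℝ) (β : Fin p → ℝ) : 𝒳 → ℝ :=
  fun x => ∑ j, β j * ψ j x

/-- The linear space `{f_β : β ∈ ℝ^p}`. -/
def linClass {𝒳 : Type*} {p : ℕ} (ψ : Fin p → 𝒳 → ℝ) : Set (𝒳 → ℝ) :=
  Set.range (linFun ψ)

/-- Squared empirical norm `P_n Z² = n⁻¹ ∑ Z_i²`, evaluated at the outcome `ω`.
A function `f` on `𝒳` is inserted as `Z_i = f (X_i)`, and `Y - f` as `Z_i = Y_i - f (X_i)`. -/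
def empNormSq {Ω : Type*} {n : ℕ} (Z : Fin n → Ω → ℝ) (ω : Ω) : ℝ :=
  (∑ i, Z i ω ^ 2) / n

/-- Squared theoretical norm `P Z² = n⁻¹ ∑ E Z_i²`. -/
def theoNormSq {Ω : Type*} [MeasurableSpace Ω] (μ : Measure Ω) {n : ℕ}
    (Z : Fin n → Ω → ℝ) : ℝ :=
  (∑ i, ∫ ω, Z i ω ^ 2 ∂μ) / n

/-- Theoretical norm `‖f‖ = (n⁻¹ ∑ E f(X_i)²)^{1/2}` of a (non-random) function `f` on `𝒳`. -/
def theoNorm {Ω 𝒳 : Type*} [MeasurableSpace Ω] (μ : Measure Ω) {n : ℕ}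
    (X : Fin n → Ω → 𝒳) (f : 𝒳 → ℝ) : ℝ :=
  √(theoNormSq μ fun i ω => f (X i ω))

/-- The Orlicz norm `inf {L > 0 : E exp |Z/L|² - 1 < 1}`, equal to `∞` if there is no such `L`. -/
def psi2Norm {Ω : Type*} [MeasurableSpace Ω] (μ : Measure Ω) (Z : Ω → ℝ) : ℝ≥0∞ :=
  sInf {l : ℝ≥0∞ | ∃ L : ℝ, 0 < L ∧ l = ENNReal.ofReal L ∧
    (∫⁻ ω, ENNReal.ofReal (Real.exp (|Z ω / L| ^ 2)) ∂μ) - 1 < 1}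

/-- `Y_1, …, Y_n` is uniformly sub-Gaussian with constant `K₀`. -/
def UniformlySubGaussian {Ω : Type*} [MeasurableSpace Ω] (μ : Measure Ω) {n : ℕ}
    (Y : Fin n → Ω → ℝ) (K₀ : ℝ≥0) : Prop :=
  ∀ i, psi2Norm μ (Y i) ≤ K₀

/-- The matrix `Σ = P ψᵀψ`, with entries `n⁻¹ ∑ E ψ_j(X_i) ψ_k(X_i)`. -/
def gram {Ω 𝒳 : Type*} [MeasurableSpace Ω] (μ : Measure Ω) {n p : ℕ}
    (X : Fin n → Ω → 𝒳) (ψ : Fin p → 𝒳 → ℝ) : Matrix (Fin p) (Fin p) ℝ :=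
  Matrix.of fun j k => (∑ i, ∫ ω, ψ j (X i ω) * ψ k (X i ω) ∂μ) / n

/-- The smallest (real) eigenvalue; used for symmetric matrices of positive size only, where
the infimum is over a nonempty finite set. -/
def minEigenvalue {p : ℕ} (A : Matrix (Fin p) (Fin p) ℝ) : ℝ :=
  sInf {l : ℝ | Module.End.HasEigenvalue (Matrix.toLin' A) l}

/-- `Λ_min`, the square root of the smallest eigenvalue of `Σ`. -/
def lambdaMin {Ω 𝒳 : Type*} [MeasurableSpace Ω] (μ : Measure Ω) {n p : ℕ}
    (X : Fin n → Ω → 𝒳) (ψ : Fin p → 𝒳 → ℝ) : ℝ :=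
  √(minEigenvalue (gram μ X ψ))

/-- `δ_n = (K_X² (1 + K₀²) p log p / (n Λ_min²))^{1/2}`. -/
def rate (n p : ℕ) (KX K₀ Λ : ℝ) : ℝ :=
  √(KX ^ 2 * (1 + K₀ ^ 2) * p * Real.log p / (n * Λ ^ 2))

/-- `f` is a least squares fit at the outcome `ω`: it minimizes `∑ (Y_i - f_β(X_i))²` over the
linear space. -/
def IsLeastSquaresFit {Ω 𝒳 : Type*} {n p : ℕ} (X : Fin n → Ω → 𝒳) (Y : Fin n → Ω → ℝ)
    (ψ : Fin p → 𝒳 → ℝ) (ω : Ω) (f : 𝒳 → ℝ) : Prop :=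
  f ∈ linClass ψ ∧ ∀ g ∈ linClass ψ,
    ∑ i, (Y i ω - f (X i ω)) ^ 2 ≤ ∑ i, (Y i ω - g (X i ω)) ^ 2

/-- `f⁰(X_i) = E(Y_i | X_i)`, as a random variable. (It is not required that the regression
function is the same for all `i`.) -/
def regression {Ω 𝒳 : Type*} [MeasurableSpace Ω] [m𝒳 : MeasurableSpace 𝒳] (μ : Measure Ω) {n : ℕ}
    (X : Fin n → Ω → 𝒳) (Y : Fin n → Ω → ℝ) (i : Fin n) : Ω → ℝ :=
  μ[Y i | MeasurableSpace.comap (X i) m𝒳]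

/-- `f` is the `L₂(P)` projection of `f⁰` on the linear space `{f_β}`: it minimizes
`‖f⁰ - f_β‖²` there. -/
def IsProjection {Ω 𝒳 : Type*} [MeasurableSpace Ω] [MeasurableSpace 𝒳] (μ : Measure Ω) {n p : ℕ}
    (X : Fin n → Ω → 𝒳) (Y : Fin n → Ω → ℝ) (ψ : Fin p → 𝒳 → ℝ) (f : 𝒳 → ℝ) : Prop :=
  f ∈ linClass ψ ∧ ∀ g ∈ linClass ψ,
    theoNormSq μ (fun i ω => regression μ X Y i ω - f (X i ω)) ≤
      theoNormSq μ (fun i ω => regression μ X Y i ω - g (X i ω))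

/-- `Z_n = O_P(r_n)`, where `Z_n` lives on the probability space `(Ω_n, μ_n)`: for every `ε > 0`
there is `C` with `P(|Z_n| > C r_n) ≤ ε` for all large `n`. -/
def IsBigOP {Ω : ℕ → Type*} [∀ n, MeasurableSpace (Ω n)] (μ : ∀ n, Measure (Ω n))
    (Z : ∀ n, Ω n → ℝ) (r : ℕ → ℝ) : Prop :=
  ∀ ε : ℝ, 0 < ε → ∃ C : ℝ, 0 < C ∧
    ∀ᶠ n in atTop, μ n {ω | C * r n < |Z n ω|} ≤ ENNReal.ofReal ε

end

end LeastSquares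

/-! Write `b` for the coefficient vector of `f̂ - f*` and `V` for the squared length of the score
vector `n⁻¹ ∑ ε_i ψ(X_i)`, with `ε_i = Y_i - f*(X_i)`. The normal equations give `‖f̂ - f*‖_n² = b ·
score ≤ |b| √V ≤ ‖f̂ - f*‖ √V / Λ_min`. If the empirical norm dominates half of the theoretical one
on the whole linear space, then `‖f̂ - f*‖² ≤ 4 V / Λ_min²`, and the empirical risks of `f̂` and
`f*` differ by exactly `‖f̂ - f*‖_n² ≤ 2 V / Λ_min²` (`fit_bounds`).

The score needs only Chebyshev: the `ε_i` are orthogonal to the linear space on average over `i`, so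
`E V` is of order `p K_X² (1 + K₀²) / n` (`score_dotProduct_integral`). For the second claim, `‖Y -
f*‖_n²` is compared with its mean through fourth moments (`empNormSq_resid_sub_integral`); that
deviation is of order `(1 + K₀²)^{1/2} δ_n`, which is where boundedness of `K₀` enters.

The norm comparison is the hard part (`measure_exists_quadForm_lt`). After whitening, it asks that
`∑ x_i x_iᵀ` have no eigenvalue below `1/2`, where `∑ E x_i x_iᵀ = 1` and `|x_i|² ≤ r = p K_X² / (n
Λ_min²)`. The potential `tr (1 + ∑ x_i x_iᵀ)^{-q}` is large as soon as one eigenvalue is small.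
Convexity of the trace of an inverse power (`trace_inv_pow_tangent`) and a rank-one perturbation
bound allow the `x_i x_iᵀ` to be replaced one at a time by `(1 - η) E x_i x_iᵀ` without decreasing
the expected potential, provided `(q + 1) r ≤ η`. Markov's inequality with `q` of order `log p`
beats the dimension factor `p`, and `r log p ≤ δ_n² → 0` makes this `q` admissible. -/

namespace LeastSquares

/-! ### Trace and quadratic-form inequalities for inverse powers of matrices. -/

section LinearAlgebra

open Matrix

set_option linter.unusedSectionVars false

variable {ι : Type*} [Fintype ι] [DecidableEq ι]

/-- `A = U diag(d) Uᵀ` with `U` orthogonal. -/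
structure IsSpectral (A U : Matrix ι ι ℝ) (d : ι → ℝ) : Prop where
  left : Uᵀ * U = 1
  right : U * Uᵀ = 1
  eq : A = U * diagonal d * Uᵀ

theorem exists_isSpectral {A : Matrix ι ι ℝ} (hA : A.IsHermitian) :
    ∃ U d, IsSpectral A U d := by
  refine ⟨hA.eigenvectorUnitary, hA.eigenvalues, ?_, ?_, ?_⟩
  · have := Unitary.coe_star_mul_self hA.eigenvectorUnitary
    simpa [star_eq_conjTranspose] using this
  · have := Unitary.coe_mul_star_self hA.eigenvectorUnitary
    simpa [star_eq_conjTranspose] using this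
  · have := hA.spectral_theorem
    simpa [star_eq_conjTranspose, Unitary.conjStarAlgAut_apply, Function.comp_def] using this

theorem IsSpectral.mul {A B U : Matrix ι ι ℝ} {d e : ι → ℝ} (hA : IsSpectral A U d)
    (hB : IsSpectral B U e) : IsSpectral (A * B) U (fun k => d k * e k) := by
  refine ⟨hA.left, hA.right, ?_⟩
  rw [hA.eq, hB.eq, ← diagonal_mul_diagonal]
  calc U * diagonal d * Uᵀ * (U * diagonal e * Uᵀ)
      = U * diagonal d * (Uᵀ * U) * diagonal e * Uᵀ := by simp only [Matrix.mul_assoc]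
    _ = _ := by rw [hA.left]; simp only [Matrix.mul_assoc, Matrix.one_mul]

theorem IsSpectral.one {A U : Matrix ι ι ℝ} {d : ι → ℝ} (hA : IsSpectral A U d) :
    IsSpectral 1 U (fun _ => 1) :=
  ⟨hA.left, hA.right, by rw [diagonal_one, Matrix.mul_one, hA.right]⟩

theorem IsSpectral.pow {A U : Matrix ι ι ℝ} {d : ι → ℝ} (hA : IsSpectral A U d) (k : ℕ) :
    IsSpectral (A ^ k) U (fun l => d l ^ k) := by
  induction k with
  | zero => simpa using hA.one
  | succ k ih => simpa only [pow_succ] using ih.mul hA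

theorem IsSpectral.inv {A U : Matrix ι ι ℝ} {d : ι → ℝ} (hA : IsSpectral A U d)
    (hd : ∀ k, 0 < d k) : IsSpectral A⁻¹ U (fun k => (d k)⁻¹) := by
  have h : IsSpectral (U * diagonal (fun k => (d k)⁻¹) * Uᵀ) U (fun k => (d k)⁻¹) :=
    ⟨hA.left, hA.right, rfl⟩
  have h1 := (hA.mul h).eq
  have h2 : (fun k => d k * (d k)⁻¹) = fun _ => (1 : ℝ) := by
    funext k; exact mul_inv_cancel₀ (hd k).ne'
  rw [h2, ← hA.one.eq] at h1
  rwa [Matrix.inv_eq_right_inv h1]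

theorem IsSpectral.trace {A U : Matrix ι ι ℝ} {d : ι → ℝ} (hA : IsSpectral A U d) :
    A.trace = ∑ k, d k := by
  rw [hA.eq, Matrix.trace_mul_comm, ← Matrix.mul_assoc, hA.left, Matrix.one_mul, trace_diagonal]

theorem IsSpectral.quadForm {A U : Matrix ι ι ℝ} {d : ι → ℝ} (hA : IsSpectral A U d)
    (x : ι → ℝ) : x ⬝ᵥ A *ᵥ x = ∑ k, d k * (Uᵀ *ᵥ x) k ^ 2 := by
  rw [hA.eq, ← mulVec_mulVec, ← mulVec_mulVec, dotProduct_mulVec, ← mulVec_transpose]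
  simp only [dotProduct, mulVec_diagonal]
  exact Finset.sum_congr rfl fun k _ => by ring

theorem IsSpectral.dotProduct_self {A U : Matrix ι ι ℝ} {d : ι → ℝ} (hA : IsSpectral A U d)
    (x : ι → ℝ) : x ⬝ᵥ x = ∑ k, (Uᵀ *ᵥ x) k ^ 2 := by
  simpa using hA.one.quadForm x

theorem IsSpectral.mulVec_col {A U : Matrix ι ι ℝ} {d : ι → ℝ} (hA : IsSpectral A U d) (k : ι) :
    A *ᵥ U.col k = d k • U.col k := by
  have h : A * U = U * diagonal d := by
    rw [hA.eq, Matrix.mul_assoc, hA.left, Matrix.mul_one]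
  ext l
  have := congrFun (congrFun h l) k
  rw [mul_diagonal] at this
  simpa [mulVec, dotProduct, Matrix.mul_apply, mul_comm] using this

theorem IsSpectral.col_dotProduct {A U : Matrix ι ι ℝ} {d : ι → ℝ} (hA : IsSpectral A U d)
    (k : ι) : U.col k ⬝ᵥ U.col k = 1 := by
  have := congrFun (congrFun hA.left k) k
  simpa [Matrix.mul_apply, dotProduct] using this

theorem IsSpectral.le_of_quadForm {A U : Matrix ι ι ℝ} {d : ι → ℝ} (hA : IsSpectral A U d)
    {c : ℝ} (h : ∀ x, c * (x ⬝ᵥ x) ≤ x ⬝ᵥ A *ᵥ x) (k : ι) : c ≤ d k := by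
  have := h (U.col k)
  rw [hA.mulVec_col, dotProduct_smul, hA.col_dotProduct] at this
  simpa using this

/-- Convexity of `t ↦ t⁻ᵠ`: the graph lies above its tangent at `a`. After factoring out `a⁻ᵠ` it
reduces to Bernoulli's inequality for `(a / b)ᵠ` together with `a / b + b / a ≥ 2`. -/
theorem bernoulli_tangent {a b : ℝ} (ha : 0 < a) (hb : 0 < b) (q : ℕ) :
    0 ≤ b⁻¹ ^ q - a⁻¹ ^ q + q * a⁻¹ ^ (q + 1) * (b - a) := by
  have hs : 0 < a / b := by positivity
  have h1 : 1 + (q : ℝ) * (a / b - 1) ≤ (a / b) ^ q := by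
    simpa using one_add_mul_le_pow (a := a / b - 1) (by linarith) q
  have h2 : 0 ≤ (q : ℝ) * (a / b - 1 + (b / a - 1)) := by
    have : a / b - 1 + (b / a - 1) = (a - b) ^ 2 / (a * b) := by field_simp; ring
    rw [this]; positivity
  have h3 : b⁻¹ ^ q - a⁻¹ ^ q + q * a⁻¹ ^ (q + 1) * (b - a)
      = a⁻¹ ^ q * ((a / b) ^ q - 1 + q * (b / a - 1)) := by
    have : b⁻¹ ^ q = a⁻¹ ^ q * (a / b) ^ q := by rw [← mul_pow]; congr 1; field_simp
    rw [this, pow_succ]; field_simp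
  rw [h3]
  have : 0 ≤ (a / b) ^ q - 1 + q * (b / a - 1) := by linarith
  positivity

/-- Klein's inequality for `t ↦ t⁻ᵠ`. -/
theorem trace_inv_pow_tangent {A C U V : Matrix ι ι ℝ} {d e : ι → ℝ} (hA : IsSpectral A U d)
    (hC : IsSpectral C V e) (hd : ∀ k, 0 < d k) (he : ∀ k, 0 < e k) (q : ℕ) :
    (A⁻¹ ^ q).trace - q * (A⁻¹ ^ (q + 1) * (C - A)).trace ≤ (C⁻¹ ^ q).trace := by
  -- The squared entries of the orthogonal matrix `W` are doubly stochastic weights, so every trace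
  -- involved is an average over pairs of eigenvalues and the scalar tangent inequality can be
  -- summed.
  set W := Uᵀ * V with hW
  have hW1 : W * Wᵀ = 1 := by
    rw [hW, transpose_mul, transpose_transpose]
    calc Uᵀ * V * (Vᵀ * U) = Uᵀ * (V * Vᵀ) * U := by simp only [Matrix.mul_assoc]
      _ = 1 := by rw [hC.right, Matrix.mul_one, hA.left]
  have hW2 : Wᵀ * W = 1 := mul_eq_one_comm.mp hW1
  have r1 : ∀ i, ∑ j, W i j ^ 2 = 1 := fun i => by
    have := congrFun (congrFun hW1 i) i
    simpa [Matrix.mul_apply, sq] using this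
  have r2 : ∀ j, ∑ i, W i j ^ 2 = 1 := fun j => by
    have := congrFun (congrFun hW2 j) j
    simpa [Matrix.mul_apply, sq] using this
  have t1 : (A⁻¹ ^ q).trace = ∑ i, ∑ j, W i j ^ 2 * (d i)⁻¹ ^ q := by
    rw [((hA.inv hd).pow q).trace]
    exact Finset.sum_congr rfl fun i _ => by rw [← Finset.sum_mul, r1, one_mul]
  have t2 : (C⁻¹ ^ q).trace = ∑ i, ∑ j, W i j ^ 2 * (e j)⁻¹ ^ q := by
    rw [((hC.inv he).pow q).trace, Finset.sum_comm]
    exact Finset.sum_congr rfl fun i _ => by rw [← Finset.sum_mul, r2, one_mul]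
  have t3 : (A⁻¹ ^ (q + 1) * A).trace = ∑ i, ∑ j, W i j ^ 2 * ((d i)⁻¹ ^ (q + 1) * d i) := by
    rw [(((hA.inv hd).pow (q + 1)).mul hA).trace]
    exact Finset.sum_congr rfl fun i _ => by rw [← Finset.sum_mul, r1, one_mul]
  have t4 : (A⁻¹ ^ (q + 1) * C).trace = ∑ i, ∑ j, W i j ^ 2 * ((d i)⁻¹ ^ (q + 1) * e j) := by
    have : (A⁻¹ ^ (q + 1) * C).trace
        = (diagonal (fun i => (d i)⁻¹ ^ (q + 1)) * (W * diagonal e * Wᵀ)).trace := by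
      rw [((hA.inv hd).pow (q + 1)).eq, hC.eq, hW, transpose_mul, transpose_transpose]
      simp only [Matrix.mul_assoc]
      rw [Matrix.trace_mul_comm]
      simp only [Matrix.mul_assoc]
    rw [this, Matrix.trace]
    refine Finset.sum_congr rfl fun i _ => ?_
    rw [diag_apply, diagonal_mul, Matrix.mul_apply, Finset.mul_sum]
    refine Finset.sum_congr rfl fun j _ => ?_
    rw [mul_diagonal, transpose_apply]; ring
  have key : 0 ≤ ∑ i, ∑ j, W i j ^ 2 *
      ((e j)⁻¹ ^ q - (d i)⁻¹ ^ q + q * (d i)⁻¹ ^ (q + 1) * (e j - d i)) :=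
    Finset.sum_nonneg fun i _ => Finset.sum_nonneg fun j _ =>
      mul_nonneg (sq_nonneg _) (bernoulli_tangent (hd i) (he j) q)
  have expand : ∑ i, ∑ j, W i j ^ 2 *
      ((e j)⁻¹ ^ q - (d i)⁻¹ ^ q + q * (d i)⁻¹ ^ (q + 1) * (e j - d i))
      = (C⁻¹ ^ q).trace - (A⁻¹ ^ q).trace
        + q * ((A⁻¹ ^ (q + 1) * C).trace - (A⁻¹ ^ (q + 1) * A).trace) := by
    rw [t1, t2, t3, t4]
    simp only [Finset.mul_sum, ← Finset.sum_sub_distrib, ← Finset.sum_add_distrib]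
    exact Finset.sum_congr rfl fun i _ => Finset.sum_congr rfl fun j _ => by ring
  rw [Matrix.mul_sub, trace_sub]
  linarith

/-- Symmetric matrices whose quadratic form dominates that of the identity. -/
structure GeOne (A : Matrix ι ι ℝ) : Prop where
  symm : Aᵀ = A
  le : ∀ x, x ⬝ᵥ x ≤ x ⬝ᵥ A *ᵥ x

theorem GeOne.exists_spectral {A : Matrix ι ι ℝ} (hA : GeOne A) :
    ∃ U d, IsSpectral A U d ∧ (∀ k, 1 ≤ d k) ∧ ∀ k, 0 < d k := by
  obtain ⟨U, d, h⟩ := exists_isSpectral (A := A) (by simpa [IsHermitian] using hA.symm)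
  have := h.le_of_quadForm (c := 1) (fun x => by simpa using hA.le x)
  exact ⟨U, d, h, this, fun k => one_pos.trans_le (this k)⟩

theorem quadForm_vecMulVec (x y : ι → ℝ) : y ⬝ᵥ vecMulVec x x *ᵥ y = (x ⬝ᵥ y) ^ 2 := by
  rw [vecMulVec_mulVec, dotProduct_smul, dotProduct_comm y x]
  simp [sq]

theorem GeOne.add {A B : Matrix ι ι ℝ} (hA : GeOne A) (hs : Bᵀ = B)
    (hB : ∀ y, 0 ≤ y ⬝ᵥ B *ᵥ y) : GeOne (A + B) := by
  refine ⟨by rw [transpose_add, hA.symm, hs], fun y => ?_⟩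
  rw [add_mulVec, dotProduct_add]
  linarith [hA.le y, hB y]

theorem transpose_vecMulVec_self (x : ι → ℝ) : (vecMulVec x x)ᵀ = vecMulVec x x := by
  rw [transpose_vecMulVec]

theorem GeOne.add_vecMulVec {A : Matrix ι ι ℝ} (hA : GeOne A) (x : ι → ℝ) :
    GeOne (A + vecMulVec x x) :=
  hA.add (transpose_vecMulVec_self x) fun y => by
    rw [quadForm_vecMulVec]; positivity

theorem GeOne.isUnit_det {A : Matrix ι ι ℝ} (hA : GeOne A) : IsUnit A.det := by
  obtain ⟨U, d, h, -, hd⟩ := hA.exists_spectral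
  have h1 := (h.mul (h.inv hd)).eq
  have h2 : (fun k => d k * (d k)⁻¹) = fun _ => (1 : ℝ) := by
    funext k; exact mul_inv_cancel₀ (hd k).ne'
  rw [h2, ← h.one.eq] at h1
  exact (Matrix.isUnit_iff_isUnit_det A).mp (IsUnit.of_mul_eq_one _ h1)

theorem GeOne.quadForm_inv_pow_nonneg {A : Matrix ι ι ℝ} (hA : GeOne A) (x : ι → ℝ) (k : ℕ) :
    0 ≤ x ⬝ᵥ A⁻¹ ^ k *ᵥ x := by
  obtain ⟨U, d, h, -, hd⟩ := hA.exists_spectral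
  rw [((h.inv hd).pow k).quadForm]
  exact Finset.sum_nonneg fun l _ => mul_nonneg (pow_nonneg (inv_nonneg.2 (hd l).le) _)
    (sq_nonneg _)

theorem GeOne.quadForm_inv_le {A : Matrix ι ι ℝ} (hA : GeOne A) (x : ι → ℝ) :
    x ⬝ᵥ A⁻¹ ^ 1 *ᵥ x ≤ x ⬝ᵥ x := by
  obtain ⟨U, d, h, hd1, hd⟩ := hA.exists_spectral
  rw [((h.inv hd).pow 1).quadForm, h.dotProduct_self]
  refine Finset.sum_le_sum fun l _ => ?_
  rw [pow_one]
  exact mul_le_of_le_one_left (sq_nonneg _) (inv_le_one_of_one_le₀ (hd1 l))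

theorem GeOne.trace_inv_pow_nonneg {A : Matrix ι ι ℝ} (hA : GeOne A) (k : ℕ) :
    0 ≤ (A⁻¹ ^ k).trace := by
  obtain ⟨U, d, h, -, hd⟩ := hA.exists_spectral
  rw [((h.inv hd).pow k).trace]
  exact Finset.sum_nonneg fun l _ => pow_nonneg (inv_nonneg.2 (hd l).le) _

theorem GeOne.trace_inv_pow_le {A : Matrix ι ι ℝ} (hA : GeOne A) (k : ℕ) :
    (A⁻¹ ^ k).trace ≤ Fintype.card ι := by
  obtain ⟨U, d, h, hd1, hd⟩ := hA.exists_spectral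
  rw [((h.inv hd).pow k).trace]
  refine (Finset.sum_le_card_nsmul _ _ 1 fun l _ => ?_).trans (by simp)
  exact pow_le_one₀ (inv_nonneg.2 (hd l).le) (inv_le_one_of_one_le₀ (hd1 l))

theorem GeOne.transpose_inv_pow {A : Matrix ι ι ℝ} (hA : GeOne A) (k : ℕ) :
    (A⁻¹ ^ k)ᵀ = A⁻¹ ^ k := by
  rw [transpose_pow, transpose_nonsing_inv, hA.symm]

/-- An entry is at most the Hilbert–Schmidt norm, whose square is `tr A⁻²ᵐ`. The crude bound serves
integrability only. -/
theorem GeOne.abs_inv_pow_apply_le {A : Matrix ι ι ℝ} (hA : GeOne A) (m : ℕ) (k l : ι) :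
    |(A⁻¹ ^ m) k l| ≤ √(Fintype.card ι) := by
  refine Real.abs_le_sqrt ?_
  have h1 : (A⁻¹ ^ (m + m)).trace = ∑ i, ∑ j, (A⁻¹ ^ m) i j ^ 2 := by
    rw [pow_add]
    nth_rewrite 2 [← hA.transpose_inv_pow m]
    simp [Matrix.trace, Matrix.mul_apply, sq]
  refine le_trans ?_ (h1 ▸ hA.trace_inv_pow_le (m + m))
  calc (A⁻¹ ^ m) k l ^ 2 ≤ ∑ j, (A⁻¹ ^ m) k j ^ 2 :=
        Finset.single_le_sum (f := fun j => (A⁻¹ ^ m) k j ^ 2) (fun j _ => sq_nonneg _)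
          (Finset.mem_univ l)
    _ ≤ _ := Finset.single_le_sum (f := fun i => ∑ j, (A⁻¹ ^ m) i j ^ 2)
          (fun i _ => Finset.sum_nonneg fun j _ => sq_nonneg _) (Finset.mem_univ k)

/-- The moments of a spectral measure satisfy `b_{i+1} b_{j+1} ≤ b_1 b_{i+j+1}`. -/
theorem GeOne.quadForm_inv_pow_mul_le {A : Matrix ι ι ℝ} (hA : GeOne A) (x : ι → ℝ) (i j : ℕ) :
    (x ⬝ᵥ A⁻¹ ^ (i + 1) *ᵥ x) * (x ⬝ᵥ A⁻¹ ^ (j + 1) *ᵥ x)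
      ≤ (x ⬝ᵥ A⁻¹ ^ 1 *ᵥ x) * (x ⬝ᵥ A⁻¹ ^ (i + j + 1) *ᵥ x) := by
  obtain ⟨U, d, h, -, hd⟩ := hA.exists_spectral
  simp only [((h.inv hd).pow _).quadForm]
  set w := fun k => (Uᵀ *ᵥ x) k ^ 2 with hw
  set b := fun k => (d k)⁻¹ with hb
  have hw0 : ∀ k, 0 ≤ w k := fun k => sq_nonneg _
  have hb0 : ∀ k, 0 ≤ b k := fun k => inv_nonneg.2 (hd k).le
  change (∑ k, b k ^ (i + 1) * w k) * (∑ k, b k ^ (j + 1) * w k)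
    ≤ (∑ k, b k ^ 1 * w k) * (∑ k, b k ^ (i + j + 1) * w k)
  -- Chebyshev's association inequality in symmetrised form: powers of the same nonnegative `b` are
  -- ordered alike. Expanding gives twice the claim.
  have key : 0 ≤ ∑ k, ∑ l, w k * w l * (b k * b l * ((b k ^ i - b l ^ i) * (b k ^ j - b l ^ j))) := by
    refine Finset.sum_nonneg fun k _ => Finset.sum_nonneg fun l _ =>
      mul_nonneg (mul_nonneg (hw0 k) (hw0 l)) (mul_nonneg (mul_nonneg (hb0 k) (hb0 l)) ?_)
    rcases le_total (b k) (b l) with hkl | hkl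
    · exact mul_nonneg_of_nonpos_of_nonpos (sub_nonpos.2 (pow_le_pow_left₀ (hb0 k) hkl i))
        (sub_nonpos.2 (pow_le_pow_left₀ (hb0 k) hkl j))
    · exact mul_nonneg (sub_nonneg.2 (pow_le_pow_left₀ (hb0 l) hkl i))
        (sub_nonneg.2 (pow_le_pow_left₀ (hb0 l) hkl j))
  have e1 : ∑ k, ∑ l, w k * w l * (b k * b l * ((b k ^ i - b l ^ i) * (b k ^ j - b l ^ j)))
      = (∑ k, b k ^ (i + j + 1) * w k) * (∑ k, b k ^ 1 * w k)
        - (∑ k, b k ^ (i + 1) * w k) * (∑ k, b k ^ (j + 1) * w k)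
        - (∑ k, b k ^ (j + 1) * w k) * (∑ k, b k ^ (i + 1) * w k)
        + (∑ k, b k ^ 1 * w k) * (∑ k, b k ^ (i + j + 1) * w k) := by
    simp only [Finset.sum_mul_sum, ← Finset.sum_sub_distrib, ← Finset.sum_add_distrib]
    exact Finset.sum_congr rfl fun k _ => Finset.sum_congr rfl fun l _ => by ring
  rw [e1] at key
  nlinarith [key]

theorem quadForm_mul_vecMulVec_mul (P Q : Matrix ι ι ℝ) (x : ι → ℝ) :
    x ⬝ᵥ (P * vecMulVec x x * Q) *ᵥ x = (x ⬝ᵥ P *ᵥ x) * (x ⬝ᵥ Q *ᵥ x) := by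
  rw [← mulVec_mulVec, ← mulVec_mulVec, vecMulVec_mulVec]
  simp [mulVec_smul, dotProduct_smul, mul_comm]

theorem pow_sub_pow_telescope (B B' : Matrix ι ι ℝ) (m : ℕ) :
    B ^ m - B' ^ m = ∑ j ∈ Finset.range m, B ^ j * (B - B') * B' ^ (m - 1 - j) := by
  induction m with
  | zero => simp
  | succ m ih =>
    have : B ^ (m + 1) - B' ^ (m + 1) = B ^ m * (B - B') + (B ^ m - B' ^ m) * B' := by
      rw [pow_succ, pow_succ]; noncomm_ring
    rw [this, ih, Finset.sum_range_succ, Finset.sum_mul, add_comm]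
    congr 1
    · refine Finset.sum_congr rfl fun j hj => ?_
      have : m + 1 - 1 - j = (m - 1 - j) + 1 := by
        have := Finset.mem_range.1 hj; omega
      rw [this, pow_succ, Matrix.mul_assoc]
    · simp

/-- Telescoping combined with the resolvent identity: the difference of inverses is `A⁻¹ x xᵀ A'⁻¹`,
and its rank-one core splits each term into a product of two quadratic forms. -/
theorem GeOne.quadForm_inv_pow_sub {A : Matrix ι ι ℝ} (hA : GeOne A) (x : ι → ℝ) (m : ℕ) :
    x ⬝ᵥ A⁻¹ ^ m *ᵥ x - x ⬝ᵥ (A + vecMulVec x x)⁻¹ ^ m *ᵥ x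
      = ∑ j ∈ Finset.range m, (x ⬝ᵥ A⁻¹ ^ (j + 1) *ᵥ x) *
          (x ⬝ᵥ (A + vecMulVec x x)⁻¹ ^ (m - 1 - j + 1) *ᵥ x) := by
  set A' := A + vecMulVec x x with hA'
  have hu := hA.isUnit_det
  have hu' := (hA.add_vecMulVec x).isUnit_det
  have hres : A⁻¹ - A'⁻¹ = A⁻¹ * vecMulVec x x * A'⁻¹ := by
    have : vecMulVec x x = A' - A := by rw [hA']; abel
    rw [this, Matrix.mul_sub, Matrix.sub_mul, Matrix.mul_assoc, mul_nonsing_inv _ hu',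
      nonsing_inv_mul _ hu, Matrix.mul_one, Matrix.one_mul]
  rw [← dotProduct_sub, ← sub_mulVec, pow_sub_pow_telescope, sum_mulVec, dotProduct_sum]
  refine Finset.sum_congr rfl fun j _ => ?_
  rw [hres, ← quadForm_mul_vecMulVec_mul, pow_succ, pow_succ']
  simp only [Matrix.mul_assoc]

/-- Adding `x xᵀ` shrinks the derivative of the potential in direction `x` by at most a factor `1 -
m |x|²`. Each of the `m` telescoped products is at most `b_1 b_m`, where `b_k = x · A⁻ᵏ x`, and `b_1
≤ |x|²`. -/
theorem GeOne.quadForm_inv_pow_rankOne {A : Matrix ι ι ℝ} (hA : GeOne A) (x : ι → ℝ) (m : ℕ) :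
    (1 - m * (x ⬝ᵥ x)) * (x ⬝ᵥ A⁻¹ ^ m *ᵥ x) ≤ x ⬝ᵥ (A + vecMulVec x x)⁻¹ ^ m *ᵥ x := by
  have hA' := hA.add_vecMulVec x
  have mono : ∀ k, x ⬝ᵥ (A + vecMulVec x x)⁻¹ ^ k *ᵥ x ≤ x ⬝ᵥ A⁻¹ ^ k *ᵥ x := fun k => by
    rw [← sub_nonneg, hA.quadForm_inv_pow_sub]
    exact Finset.sum_nonneg fun j _ => mul_nonneg (hA.quadForm_inv_pow_nonneg x _)
      (hA'.quadForm_inv_pow_nonneg x _)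
  have h : x ⬝ᵥ A⁻¹ ^ m *ᵥ x - x ⬝ᵥ (A + vecMulVec x x)⁻¹ ^ m *ᵥ x
      ≤ m * ((x ⬝ᵥ x) * (x ⬝ᵥ A⁻¹ ^ m *ᵥ x)) := by
    rw [hA.quadForm_inv_pow_sub]
    refine (Finset.sum_le_card_nsmul _ _ ((x ⬝ᵥ x) * (x ⬝ᵥ A⁻¹ ^ m *ᵥ x)) fun j hj => ?_).trans
      (by simp)
    have hjm := Finset.mem_range.1 hj
    refine (mul_le_mul_of_nonneg_left (mono _) (hA.quadForm_inv_pow_nonneg x _)).trans ?_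
    refine (hA.quadForm_inv_pow_mul_le x j (m - 1 - j)).trans ?_
    rw [show j + (m - 1 - j) + 1 = m by omega]
    exact mul_le_mul_of_nonneg_right (hA.quadForm_inv_le x) (hA.quadForm_inv_pow_nonneg x _)
  linarith

theorem trace_mul_vecMulVec (P : Matrix ι ι ℝ) (x : ι → ℝ) :
    (P * vecMulVec x x).trace = x ⬝ᵥ P *ᵥ x := by
  rw [mul_vecMulVec, trace_vecMulVec, dotProduct_comm]

/-- Convexity bounds the decrease from below by the derivative at the endpoint `A + x xᵀ`; the
rank-one estimate with `m = q + 1` moves that derivative back to `A`, at the price of the factor `1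
- η`. -/
theorem GeOne.trace_inv_pow_add_vecMulVec_le {A : Matrix ι ι ℝ} (hA : GeOne A) (x : ι → ℝ)
    (q : ℕ) {η : ℝ} (hη : ((q : ℝ) + 1) * (x ⬝ᵥ x) ≤ η) :
    ((A + vecMulVec x x)⁻¹ ^ q).trace
      ≤ (A⁻¹ ^ q).trace - q * ((1 - η) * (x ⬝ᵥ A⁻¹ ^ (q + 1) *ᵥ x)) := by
  obtain ⟨U, d, h, -, hd⟩ := hA.exists_spectral
  obtain ⟨V, e, h', -, he⟩ := (hA.add_vecMulVec x).exists_spectral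
  have h1 := trace_inv_pow_tangent h' h he hd q
  rw [sub_add_cancel_left, Matrix.mul_neg, trace_neg, trace_mul_vecMulVec] at h1
  have h2 := hA.quadForm_inv_pow_rankOne x (q + 1)
  have h3 : (1 - η) * (x ⬝ᵥ A⁻¹ ^ (q + 1) *ᵥ x)
      ≤ (1 - ((q + 1 : ℕ) : ℝ) * (x ⬝ᵥ x)) * (x ⬝ᵥ A⁻¹ ^ (q + 1) *ᵥ x) := by
    refine mul_le_mul_of_nonneg_right ?_ (hA.quadForm_inv_pow_nonneg x _)
    push_cast; linarith
  have h4 := mul_le_mul_of_nonneg_left (h3.trans h2) (Nat.cast_nonneg (α := ℝ) q)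
  linarith

theorem GeOne.trace_inv_pow_add_ge {A B : Matrix ι ι ℝ} (hA : GeOne A) (hs : Bᵀ = B)
    (hB : ∀ y, 0 ≤ y ⬝ᵥ B *ᵥ y) (q : ℕ) :
    (A⁻¹ ^ q).trace - q * (A⁻¹ ^ (q + 1) * B).trace ≤ ((A + B)⁻¹ ^ q).trace := by
  obtain ⟨U, d, h, -, hd⟩ := hA.exists_spectral
  obtain ⟨V, e, h', -, he⟩ := (hA.add hs hB).exists_spectral
  simpa using trace_inv_pow_tangent h h' hd he q

theorem GeOne.le_trace_inv_pow {A : Matrix ι ι ℝ} (hA : GeOne A) {c : ℝ} (hc : 0 < c)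
    {x : ι → ℝ} (hx : x ⬝ᵥ A *ᵥ x < c * (x ⬝ᵥ x)) (q : ℕ) : c⁻¹ ^ q ≤ (A⁻¹ ^ q).trace := by
  obtain ⟨U, d, h, -, hd⟩ := hA.exists_spectral
  obtain ⟨k, hk⟩ : ∃ k, d k < c := by
    by_contra! hcon
    rw [h.quadForm, h.dotProduct_self, Finset.mul_sum] at hx
    exact absurd hx (not_lt.2 (Finset.sum_le_sum fun k _ =>
      mul_le_mul_of_nonneg_right (hcon k) (sq_nonneg _)))
  rw [((h.inv hd).pow q).trace]
  refine le_trans ?_ (Finset.single_le_sum (f := fun l => (d l)⁻¹ ^ q)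
    (fun l _ => pow_nonneg (inv_nonneg.2 (hd l).le) _) (Finset.mem_univ k))
  exact pow_le_pow_left₀ (inv_nonneg.2 hc.le) (inv_anti₀ (hd k) hk.le) q

end LinearAlgebra

/-! ### Lower tail of the smallest eigenvalue of a random sum of rank-one matrices. -/

section MatrixConcentration

open Matrix

set_option linter.unusedSectionVars false

variable {ι : Type*} [Fintype ι] [DecidableEq ι]

theorem measurable_inv_pow_apply {E : Type*} [TopologicalSpace E] [MeasurableSpace E]
    [OpensMeasurableSpace E] {A : E → Matrix ι ι ℝ} (hA : Continuous A) (m : ℕ) (k l : ι) :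
    Measurable fun y => ((A y)⁻¹ ^ m) k l := by
  induction m generalizing k l with
  | zero => simp
  | succ m ih =>
    simp only [pow_succ, Matrix.mul_apply]
    refine Finset.measurable_sum _ fun s _ => (ih k s).mul ?_
    simp only [Matrix.inv_def, Ring.inverse_eq_inv', Matrix.smul_apply, smul_eq_mul]
    exact hA.matrix_det.measurable.inv.mul
      ((hA.matrix_adjugate.matrix_elem s l).measurable)

theorem GeOne.add_sum {κ : Type*} {A : Matrix ι ι ℝ} (hA : GeOne A) (S : Finset κ)
    (y : κ → ι → ℝ) : GeOne (A + ∑ i ∈ S, vecMulVec (y i) (y i)) := by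
  classical
  induction S using Finset.induction_on with
  | empty => simpa using hA
  | insert a S ha ih =>
    rw [Finset.sum_insert ha, add_comm (vecMulVec _ _), ← add_assoc]
    exact ih.add_vecMulVec _

variable {Ω : Type*} [MeasurableSpace Ω]

/-- The matrix `E x xᵀ`. -/
noncomputable def secondMoment (μ : Measure Ω) (x : Ω → ι → ℝ) : Matrix ι ι ℝ :=
  Matrix.of fun k l => ∫ ω, x ω k * x ω l ∂μ

theorem transpose_secondMoment (μ : Measure Ω) (x : Ω → ι → ℝ) :
    (secondMoment μ x)ᵀ = secondMoment μ x := by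
  ext k l; simp [secondMoment, mul_comm]

variable {μ : Measure Ω} [IsProbabilityMeasure μ]

theorem integrable_coord_mul {x : Ω → ι → ℝ} (hx : Measurable x) {r : ℝ}
    (hr : ∀ᵐ ω ∂μ, x ω ⬝ᵥ x ω ≤ r) (k l : ι) : Integrable (fun ω => x ω k * x ω l) μ := by
  refine Integrable.of_bound (by fun_prop) r ?_
  filter_upwards [hr] with ω hω
  have h : ∀ j, x ω j ^ 2 ≤ r := fun j => le_trans (by
    simpa [dotProduct, sq] using Finset.single_le_sum (f := fun j => x ω j * x ω j)
      (fun i _ => mul_self_nonneg _) (Finset.mem_univ j)) hω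
  rw [Real.norm_eq_abs, abs_le]
  constructor <;> nlinarith [h k, h l, sq_nonneg (x ω k - x ω l), sq_nonneg (x ω k + x ω l)]

theorem quadForm_secondMoment {x : Ω → ι → ℝ} (hx : Measurable x) {r : ℝ}
    (hr : ∀ᵐ ω ∂μ, x ω ⬝ᵥ x ω ≤ r) (y : ι → ℝ) :
    y ⬝ᵥ secondMoment μ x *ᵥ y = ∫ ω, (x ω ⬝ᵥ y) ^ 2 ∂μ := by
  have h : ∀ ω, (x ω ⬝ᵥ y) ^ 2 = ∑ k, ∑ l, y k * y l * (x ω k * x ω l) := fun ω => by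
    rw [sq, dotProduct, Finset.sum_mul_sum]
    exact Finset.sum_congr rfl fun k _ => Finset.sum_congr rfl fun l _ => by ring
  simp only [h]
  have hi := integrable_coord_mul hx hr
  rw [integral_finsetSum _ fun k _ => integrable_finsetSum _ fun l _ => (hi k l).const_mul _]
  simp only [dotProduct, mulVec, Finset.mul_sum, secondMoment, of_apply]
  refine Finset.sum_congr rfl fun k _ => ?_
  rw [integral_finsetSum _ fun l _ => (hi k l).const_mul _]
  refine Finset.sum_congr rfl fun l _ => ?_
  rw [integral_const_mul]; ring

theorem quadForm_secondMoment_nonneg {x : Ω → ι → ℝ} (hx : Measurable x) {r : ℝ}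
    (hr : ∀ᵐ ω ∂μ, x ω ⬝ᵥ x ω ≤ r) (y : ι → ℝ) : 0 ≤ y ⬝ᵥ secondMoment μ x *ᵥ y := by
  rw [quadForm_secondMoment hx hr]
  exact integral_nonneg fun ω => sq_nonneg _

theorem secondMoment_mulVec {x : Ω → ι → ℝ} (hx : Measurable x) {r : ℝ} (hr : ∀ᵐ ω ∂μ, x ω ⬝ᵥ x ω ≤ r)
    (B : Matrix ι ι ℝ) :
    secondMoment μ (fun ω => B *ᵥ x ω) = B * secondMoment μ x * Bᵀ := by
  have hi := integrable_coord_mul hx hr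
  ext k l
  have h : ∀ ω, (B *ᵥ x ω) k * (B *ᵥ x ω) l
      = ∑ b, ∑ a, B k a * (x ω a * x ω b) * B l b := fun ω => by
    simp only [mulVec, dotProduct, Finset.sum_mul_sum]
    rw [Finset.sum_comm]
    exact Finset.sum_congr rfl fun b _ => Finset.sum_congr rfl fun a _ => by ring
  simp only [secondMoment, of_apply, h, Matrix.mul_apply, transpose_apply, Finset.sum_mul]
  rw [integral_finsetSum _ fun b _ => integrable_finsetSum _ fun a _ =>
    ((hi a b).const_mul _).mul_const _]
  refine Finset.sum_congr rfl fun b _ => ?_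
  rw [integral_finsetSum _ fun a _ => ((hi a b).const_mul _).mul_const _]
  refine Finset.sum_congr rfl fun a _ => ?_
  rw [integral_mul_const, integral_const_mul]

variable {κ : Type*} {x : κ → Ω → ι → ℝ}

theorem continuous_add_sum (A : Matrix ι ι ℝ) (S : Finset κ) :
    Continuous fun y : S → ι → ℝ => A + ∑ i, vecMulVec (y i) (y i) := by
  refine continuous_const.add (continuous_finsetSum _ fun i _ => ?_)
  exact (continuous_apply i).matrix_vecMulVec (continuous_apply i)

theorem measurable_comp_tuple (hx : ∀ i, Measurable (x i)) (A : Matrix ι ι ℝ) (S : Finset κ)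
    (m : ℕ) (k l : ι) :
    Measurable fun ω => ((A + ∑ i ∈ S, vecMulVec (x i ω) (x i ω))⁻¹ ^ m) k l := by
  have h := (measurable_inv_pow_apply (continuous_add_sum A S) m k l).comp
    (g := fun y : S → ι → ℝ => ((A + ∑ i, vecMulVec (y i) (y i))⁻¹ ^ m) k l)
    (f := fun ω (i : S) => x i ω) (measurable_pi_lambda _ fun i => hx i)
  convert h using 1
  funext ω
  simp only [Function.comp]
  rw [Finset.sum_coe_sort S fun i => vecMulVec (x i ω) (x i ω)]

theorem integrable_inv_pow_apply (hx : ∀ i, Measurable (x i)) {A : Matrix ι ι ℝ} (hA : GeOne A)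
    (S : Finset κ) (m : ℕ) (k l : ι) :
    Integrable (fun ω => ((A + ∑ i ∈ S, vecMulVec (x i ω) (x i ω))⁻¹ ^ m) k l) μ :=
  Integrable.of_bound (measurable_comp_tuple hx A S m k l).aestronglyMeasurable
    (√(Fintype.card ι)) (ae_of_all _ fun ω =>
      (hA.add_sum S fun i => x i ω).abs_inv_pow_apply_le m k l)

theorem integrable_trace_inv_pow (hx : ∀ i, Measurable (x i)) {A : Matrix ι ι ℝ} (hA : GeOne A)
    (S : Finset κ) (m : ℕ) :
    Integrable (fun ω => ((A + ∑ i ∈ S, vecMulVec (x i ω) (x i ω))⁻¹ ^ m).trace) μ := by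
  simp only [Matrix.trace, diag_apply]
  exact integrable_finsetSum _ fun k _ => integrable_inv_pow_apply hx hA S m k k

theorem indepFun_inv_pow_apply (hx : ∀ i, Measurable (x i)) (hind : iIndepFun x μ)
    (A : Matrix ι ι ℝ) {S : Finset κ} {a : κ} (ha : a ∉ S) (m : ℕ) (k l : ι) :
    IndepFun (fun ω => ((A + ∑ i ∈ S, vecMulVec (x i ω) (x i ω))⁻¹ ^ m) k l)
      (fun ω => x a ω k * x a ω l) μ := by
  have h := (hind.indepFun_finset S {a} (Finset.disjoint_singleton_right.2 ha) hx).comp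
    (φ := fun y : S → ι → ℝ => ((A + ∑ i, vecMulVec (y i) (y i))⁻¹ ^ m) k l)
    (ψ := fun z : ({a} : Finset κ) → ι → ℝ =>
      z ⟨a, Finset.mem_singleton_self a⟩ k * z ⟨a, Finset.mem_singleton_self a⟩ l)
    (measurable_inv_pow_apply (continuous_add_sum A S) m k l) (by fun_prop)
  have e : (fun ω => ((A + ∑ i ∈ S, vecMulVec (x i ω) (x i ω))⁻¹ ^ m) k l)
      = (fun y : S → ι → ℝ => ((A + ∑ i, vecMulVec (y i) (y i))⁻¹ ^ m) k l) ∘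
        fun ω (i : S) => x i ω := by
    funext ω
    simp only [Function.comp]
    rw [Finset.sum_coe_sort S fun i => vecMulVec (x i ω) (x i ω)]
  rw [e]
  exact h

theorem quadForm_eq_sum (P : Matrix ι ι ℝ) (y : ι → ℝ) :
    y ⬝ᵥ P *ᵥ y = ∑ k, ∑ l, P k l * (y k * y l) := by
  simp only [dotProduct, mulVec, Finset.mul_sum]
  exact Finset.sum_congr rfl fun k _ => Finset.sum_congr rfl fun l _ => by ring

theorem integrable_quadForm_inv_pow (hx : ∀ i, Measurable (x i)) (hind : iIndepFun x μ) {r : ℝ}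
    (hr : ∀ i, ∀ᵐ ω ∂μ, x i ω ⬝ᵥ x i ω ≤ r) {A : Matrix ι ι ℝ} (hA : GeOne A)
    {S : Finset κ} {a : κ} (ha : a ∉ S) (m : ℕ) :
    Integrable (fun ω => x a ω ⬝ᵥ
      (A + ∑ i ∈ S, vecMulVec (x i ω) (x i ω))⁻¹ ^ m *ᵥ x a ω) μ := by
  simp only [quadForm_eq_sum]
  exact integrable_finsetSum _ fun k _ => integrable_finsetSum _ fun l _ =>
    (indepFun_inv_pow_apply hx hind A ha m k l).integrable_mul
      (integrable_inv_pow_apply hx hA S m k l) (integrable_coord_mul (hx a) (hr a) k l)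

/-- The vector `x a` is independent of the matrix built from the indices in `S`, so `x a (x a)ᵀ` may
be averaged first. -/
theorem integral_quadForm_inv_pow (hx : ∀ i, Measurable (x i)) (hind : iIndepFun x μ) {r : ℝ}
    (hr : ∀ i, ∀ᵐ ω ∂μ, x i ω ⬝ᵥ x i ω ≤ r) {A : Matrix ι ι ℝ} (hA : GeOne A)
    {S : Finset κ} {a : κ} (ha : a ∉ S) (m : ℕ) :
    ∫ ω, x a ω ⬝ᵥ (A + ∑ i ∈ S, vecMulVec (x i ω) (x i ω))⁻¹ ^ m *ᵥ x a ω ∂μ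
      = ∫ ω, ((A + ∑ i ∈ S, vecMulVec (x i ω) (x i ω))⁻¹ ^ m * secondMoment μ (x a)).trace ∂μ := by
  have hN := integrable_inv_pow_apply (μ := μ) hx hA S m
  have hM := integrable_coord_mul (hx a) (hr a)
  have hI := indepFun_inv_pow_apply hx hind A ha m
  have hNM : ∀ k l, Integrable (fun ω => ((A + ∑ i ∈ S, vecMulVec (x i ω) (x i ω))⁻¹ ^ m) k l *
      (x a ω k * x a ω l)) μ := fun k l => (hI k l).integrable_mul (hN k l) (hM k l)
  simp only [quadForm_eq_sum, Matrix.trace, diag_apply, Matrix.mul_apply]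
  rw [integral_finsetSum _ fun k _ => integrable_finsetSum _ fun l _ => hNM k l,
    integral_finsetSum _ fun k _ => integrable_finsetSum _ fun l _ => (hN k l).mul_const _]
  refine Finset.sum_congr rfl fun k _ => ?_
  rw [integral_finsetSum _ fun l _ => hNM k l,
    integral_finsetSum _ fun l _ => (hN k l).mul_const _]
  refine Finset.sum_congr rfl fun l _ => ?_
  rw [(hI k l).integral_fun_mul_eq_mul_integral (hN k l).aestronglyMeasurable
    (hM k l).aestronglyMeasurable, integral_mul_const]
  simp [secondMoment, mul_comm]

/-- Replacing the random rank-one matrices by a multiple of their expectations can only increase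
the expected trace of the inverse power. -/
theorem integral_trace_inv_pow_le (hx : ∀ i, Measurable (x i)) (hind : iIndepFun x μ) {r : ℝ}
    (hr : ∀ i, ∀ᵐ ω ∂μ, x i ω ⬝ᵥ x i ω ≤ r) (q : ℕ) {η : ℝ} (hη : ((q : ℝ) + 1) * r ≤ η)
    (hη1 : η ≤ 1) (S : Finset κ) {A : Matrix ι ι ℝ} (hA : GeOne A) :
    ∫ ω, ((A + ∑ i ∈ S, vecMulVec (x i ω) (x i ω))⁻¹ ^ q).trace ∂μ
      ≤ ((A + (1 - η) • ∑ i ∈ S, secondMoment μ (x i))⁻¹ ^ q).trace := by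
  classical
  induction S using Finset.induction_on generalizing A with
  | empty => simp
  | insert a S ha ih =>
    set M := (1 - η) • secondMoment μ (x a) with hM
    have hMs : Mᵀ = M := by rw [hM, transpose_smul, transpose_secondMoment]
    have hM0 : ∀ y, 0 ≤ y ⬝ᵥ M *ᵥ y := fun y => by
      rw [hM, smul_mulVec, dotProduct_smul]
      exact mul_nonneg (by linarith) (quadForm_secondMoment_nonneg (hx a) (hr a) y)
    -- The averaged term `M` is absorbed into the base matrix, which is why the induction runs over
    -- arbitrary `A`. It remains to exchange the single random term `x a` for `M`.
    have h2 := ih (hA.add hMs hM0)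
    have e2 : A + M + (1 - η) • ∑ i ∈ S, secondMoment μ (x i)
        = A + (1 - η) • ∑ i ∈ insert a S, secondMoment μ (x i) := by
      rw [Finset.sum_insert ha, smul_add, hM]; abel
    rw [e2] at h2
    refine le_trans ?_ h2
    set D := fun ω => A + ∑ i ∈ S, vecMulVec (x i ω) (x i ω) with hD
    have hD1 : ∀ ω, GeOne (D ω) := fun ω => hA.add_sum S fun i => x i ω
    have iD := integrable_trace_inv_pow (μ := μ) hx hA S q
    have iQ := integrable_quadForm_inv_pow hx hind hr hA ha (q + 1)
    have iN := integrable_inv_pow_apply (μ := μ) hx hA S (q + 1)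
    have iT : Integrable (fun ω => ((D ω)⁻¹ ^ (q + 1) * secondMoment μ (x a)).trace) μ := by
      simp only [Matrix.trace, diag_apply, Matrix.mul_apply]
      exact integrable_finsetSum _ fun k _ => integrable_finsetSum _ fun l _ =>
        (iN k l).mul_const _
    -- An upper bound for the step along `x a (x a)ᵀ` and the tangent lower bound for the step along
    -- `M` have the same linear term in expectation; `M` carries the factor `1 - η` exactly for this
    -- match.
    calc ∫ ω, ((A + ∑ i ∈ insert a S, vecMulVec (x i ω) (x i ω))⁻¹ ^ q).trace ∂μ
        ≤ ∫ ω, (((D ω)⁻¹ ^ q).trace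
            - q * ((1 - η) * (x a ω ⬝ᵥ (D ω)⁻¹ ^ (q + 1) *ᵥ x a ω))) ∂μ := by
          refine integral_mono_ae (integrable_trace_inv_pow hx hA _ q)
            (iD.sub ((iQ.const_mul _).const_mul _)) ?_
          filter_upwards [hr a] with ω hω
          have := (hD1 ω).trace_inv_pow_add_vecMulVec_le (x a ω) q
            ((mul_le_mul_of_nonneg_left hω (by positivity)).trans hη)
          rwa [show D ω + vecMulVec (x a ω) (x a ω)
            = A + ∑ i ∈ insert a S, vecMulVec (x i ω) (x i ω) by
              rw [Finset.sum_insert ha, add_comm (vecMulVec _ _), ← add_assoc]] at this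
      _ = ∫ ω, (((D ω)⁻¹ ^ q).trace
            - q * ((1 - η) * ((D ω)⁻¹ ^ (q + 1) * secondMoment μ (x a)).trace)) ∂μ := by
          rw [integral_sub iD ((iQ.const_mul _).const_mul _),
            integral_sub iD ((iT.const_mul _).const_mul _)]
          simp only [integral_const_mul]
          rw [integral_quadForm_inv_pow hx hind hr hA ha]
      _ ≤ _ := by
          refine integral_mono (iD.sub ((iT.const_mul _).const_mul _))
            (integrable_trace_inv_pow hx (hA.add hMs hM0) S q) fun ω => ?_
          have := (hD1 ω).trace_inv_pow_add_ge hMs hM0 q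
          rw [hM, Matrix.mul_smul, trace_smul, smul_eq_mul, ← hM] at this
          rwa [show D ω + M = A + M + ∑ i ∈ S, vecMulVec (x i ω) (x i ω) from
            add_right_comm _ _ _] at this

theorem geOne_one : GeOne (1 : Matrix ι ι ℝ) := ⟨transpose_one, fun x => by simp⟩

theorem trace_inv_pow_smul_one {c : ℝ} (hc : c ≠ 0) (q : ℕ) :
    ((c • (1 : Matrix ι ι ℝ))⁻¹ ^ q).trace = Fintype.card ι * c⁻¹ ^ q := by
  have : (c • (1 : Matrix ι ι ℝ))⁻¹ = c⁻¹ • 1 := by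
    refine Matrix.inv_eq_right_inv ?_
    rw [Matrix.smul_mul, Matrix.one_mul, smul_smul, mul_inv_cancel₀ hc, one_smul]
  rw [this, smul_pow, one_pow, trace_smul, trace_one, smul_eq_mul, mul_comm]

/-- Lower tail of the smallest eigenvalue of a sum of independent, isotropic on average,
bounded rank-one matrices. -/
theorem measure_exists_quadForm_lt [Fintype κ] (hx : ∀ i, Measurable (x i))
    (hind : iIndepFun x μ) {r : ℝ} (hr : ∀ i, ∀ᵐ ω ∂μ, x i ω ⬝ᵥ x i ω ≤ r)
    (hiso : ∑ i, secondMoment μ (x i) = 1) (q : ℕ) (hq : ((q : ℝ) + 1) * r ≤ 1 / 4) :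
    μ {ω | ∃ y : ι → ℝ, ∑ i, (x i ω ⬝ᵥ y) ^ 2 < 1 / 2 * (y ⬝ᵥ y)}
      ≤ ENNReal.ofReal (Fintype.card ι * (6 / 7) ^ q) := by
  -- With `η = 1/4` the expected potential is at most `card ι · (4/7)^q`, since `1 + 3/4 = 7/4`. On
  -- the bad event an eigenvalue lies below `1 + 1/2`, so the potential is at least `(2/3)^q`. The
  -- quotient gives `6/7`.
  have h1 := integral_trace_inv_pow_le hx hind hr q hq (by norm_num) Finset.univ geOne_one
  rw [hiso, show (1 : Matrix ι ι ℝ) + (1 - 1 / 4 : ℝ) • 1 = (7 / 4 : ℝ) • 1 by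
    nth_rewrite 1 [← one_smul ℝ (1 : Matrix ι ι ℝ)]; rw [← add_smul]; norm_num,
    trace_inv_pow_smul_one (by norm_num)] at h1
  set F := fun ω => (((1 : Matrix ι ι ℝ) + ∑ i, vecMulVec (x i ω) (x i ω))⁻¹ ^ q).trace with hF
  have hG : ∀ ω, GeOne ((1 : Matrix ι ι ℝ) + ∑ i, vecMulVec (x i ω) (x i ω)) :=
    fun ω => geOne_one.add_sum _ fun i => x i ω
  have h2 := mul_meas_ge_le_integral_of_nonneg (μ := μ) (f := F)
    (ae_of_all _ fun ω => (hG ω).trace_inv_pow_nonneg q)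
    (integrable_trace_inv_pow hx geOne_one _ q) ((3 / 2 : ℝ)⁻¹ ^ q)
  have h3 : μ.real {ω | (3 / 2 : ℝ)⁻¹ ^ q ≤ F ω} ≤ Fintype.card ι * (6 / 7) ^ q := by
    have h4 := h2.trans h1
    have h5 : (0 : ℝ) < (3 / 2 : ℝ)⁻¹ ^ q := by positivity
    refine le_of_mul_le_mul_left (h4.trans (le_of_eq ?_)) h5
    rw [mul_left_comm, ← mul_pow]; norm_num
  refine (measure_mono ?_).trans (?_ : μ {ω | (3 / 2 : ℝ)⁻¹ ^ q ≤ F ω} ≤ _)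
  · rintro ω ⟨y, hy⟩
    refine (hG ω).le_trace_inv_pow (by norm_num) (x := y) ?_ q
    rw [add_mulVec, dotProduct_add, one_mulVec, sum_mulVec, dotProduct_sum]
    simp only [quadForm_vecMulVec]
    linarith
  · rw [← ofReal_measureReal]
    exact ENNReal.ofReal_le_ofReal h3

end MatrixConcentration

/-! ### Markov's inequality, sub-Gaussian moments and variances of independent sums. -/

section Moments

variable {Ω : Type*} [MeasurableSpace Ω] {μ : Measure Ω}

theorem measure_ge_le_of_integral_le [IsFiniteMeasure μ] {f : Ω → ℝ} (hf : Integrable f μ)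
    (h0 : ∀ ω, 0 ≤ f ω) {b c : ℝ} (hb : ∫ ω, f ω ∂μ ≤ b) (hc : 0 < c) :
    μ {ω | c ≤ f ω} ≤ ENNReal.ofReal (b / c) := by
  rw [← ofReal_measureReal]
  refine ENNReal.ofReal_le_ofReal ?_
  rw [le_div_iff₀' hc]
  exact (mul_meas_ge_le_integral_of_nonneg (ae_of_all _ h0) hf c).trans hb

variable [IsProbabilityMeasure μ]

/-- Second and fourth moments of a sub-Gaussian variable. -/
theorem moments_of_psi2Norm_le {Z : Ω → ℝ} (hZ : Measurable Z) {K₀ : ℝ≥0}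
    (h : psi2Norm μ Z ≤ K₀) :
    MemLp Z 2 μ ∧ Integrable (fun ω => Z ω ^ 4) μ ∧
      ∫ ω, Z ω ^ 2 ∂μ ≤ 2 * (1 + (K₀ : ℝ) ^ 2) ∧
      ∫ ω, Z ω ^ 4 ∂μ ≤ 2 * (2 * (1 + (K₀ : ℝ) ^ 2)) ^ 2 := by
  -- The infimum need not be attained and `K₀` may vanish, so an admissible `L` is taken below `K₀ +
  -- 1`; this is the source of `1 + K₀²`.
  have hlt : psi2Norm μ Z < ENNReal.ofReal (K₀ + 1) := by
    refine h.trans_lt ?_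
    rw [← ENNReal.ofReal_coe_nnreal]
    exact (ENNReal.ofReal_lt_ofReal_iff (by positivity)).2 (by linarith)
  obtain ⟨l, ⟨L, hL0, rfl, hint⟩, hl⟩ := sInf_lt_iff.1 hlt
  have hL : L < K₀ + 1 := (ENNReal.ofReal_lt_ofReal_iff (by positivity)).1 hl
  have hL2 : L ^ 2 ≤ 2 * (1 + (K₀ : ℝ) ^ 2) := by
    have : L ^ 2 ≤ ((K₀ : ℝ) + 1) ^ 2 := pow_le_pow_left₀ hL0.le hL.le 2
    nlinarith [sq_nonneg ((K₀ : ℝ) - 1)]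
  set u : Ω → ℝ := fun ω => (Z ω / L) ^ 2 with hu
  have hu0 : ∀ ω, 0 ≤ u ω := fun ω => sq_nonneg _
  -- The quadratic Taylor polynomial lies below `exp u`, so `E F ≤ 2`, whence `E u ≤ 1` and `E u² ≤
  -- 2`.
  set F : Ω → ℝ := fun ω => 1 + u ω + u ω ^ 2 / 2 with hF
  have hum : Measurable u := by fun_prop
  have hFm : Measurable F := by fun_prop
  have hF0 : ∀ ω, 0 ≤ F ω := fun ω => by have := hu0 ω; positivity
  have hlF : ∫⁻ ω, ENNReal.ofReal (F ω) ∂μ ≤ 2 := by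
    have h1 : ∫⁻ ω, ENNReal.ofReal (Real.exp (|Z ω / L| ^ 2)) ∂μ ≤ 2 := by
      have := tsub_le_iff_right.1 hint.le
      rwa [one_add_one_eq_two] at this
    refine le_trans (lintegral_mono fun ω => ENNReal.ofReal_le_ofReal ?_) h1
    rw [sq_abs]
    exact Real.quadratic_le_exp_of_nonneg (hu0 ω)
  have iF : Integrable F μ :=
    (lintegral_ofReal_ne_top_iff_integrable hFm.aestronglyMeasurable (ae_of_all _ hF0)).1
      (ne_top_of_le_ne_top (by norm_num) hlF)
  have hF2 : ∫ ω, F ω ∂μ ≤ 2 := by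
    rw [← ofReal_integral_eq_lintegral_ofReal iF (ae_of_all _ hF0)] at hlF
    have : ENNReal.ofReal (∫ ω, F ω ∂μ) ≤ ENNReal.ofReal 2 := by simpa using hlF
    exact (ENNReal.ofReal_le_ofReal_iff (by norm_num)).1 this
  have iu : Integrable u μ := iF.mono' hum.aestronglyMeasurable (ae_of_all _ fun ω => by
    rw [Real.norm_eq_abs, abs_of_nonneg (hu0 ω)]
    have := sq_nonneg (u ω); simp only [hF]; linarith)
  have iu2 : Integrable (fun ω => u ω ^ 2) μ := by
    refine (iF.const_mul 2).mono' (hum.pow_const 2).aestronglyMeasurable (ae_of_all _ fun ω => ?_)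
    rw [Real.norm_eq_abs, abs_of_nonneg (sq_nonneg _)]
    have := hu0 ω; simp only [hF]; linarith
  have hsum : ∫ ω, F ω ∂μ = 1 + ∫ ω, u ω ∂μ + (∫ ω, u ω ^ 2 ∂μ) / 2 := by
    simp only [hF]
    have i1 : Integrable (fun ω => 1 + u ω) μ := (integrable_const _).add iu
    rw [integral_add i1 (iu2.div_const 2), integral_add (integrable_const _) iu, integral_div]
    simp
  have n1 : 0 ≤ ∫ ω, u ω ∂μ := integral_nonneg hu0
  have n2 : 0 ≤ ∫ ω, u ω ^ 2 ∂μ := integral_nonneg fun ω => sq_nonneg _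
  have e2 : (fun ω => Z ω ^ 2) = fun ω => L ^ 2 * u ω := by
    funext ω; simp only [hu]; field_simp
  have e4 : (fun ω => Z ω ^ 4) = fun ω => (L ^ 2) ^ 2 * u ω ^ 2 := by
    funext ω; simp only [hu]; field_simp
  refine ⟨(memLp_two_iff_integrable_sq hZ.aestronglyMeasurable).2 (e2 ▸ iu.const_mul _),
    e4 ▸ iu2.const_mul _, ?_, ?_⟩
  · rw [e2, integral_const_mul]
    have : ∫ ω, u ω ∂μ ≤ 1 := by linarith
    nlinarith [sq_nonneg L]
  · rw [e4, integral_const_mul]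
    have h1 : ∫ ω, u ω ^ 2 ∂μ ≤ 2 := by linarith
    have h2 : (L ^ 2) ^ 2 ≤ (2 * (1 + (K₀ : ℝ) ^ 2)) ^ 2 := pow_le_pow_left₀ (sq_nonneg _) hL2 2
    nlinarith [sq_nonneg (L ^ 2)]

/-- Second moment of a centred sum of independent variables. -/
theorem integral_sq_centered_sum_le {κ : Type*} [Fintype κ] {Z : κ → Ω → ℝ}
    (hZ : ∀ i, MemLp (Z i) 2 μ) (hind : Pairwise fun i j => IndepFun (Z i) (Z j) μ) :
    Integrable (fun ω => (∑ i, Z i ω - ∑ i, ∫ ω, Z i ω ∂μ) ^ 2) μ ∧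
    ∫ ω, (∑ i, Z i ω - ∑ i, ∫ ω, Z i ω ∂μ) ^ 2 ∂μ ≤ ∑ i, ∫ ω, Z i ω ^ 2 ∂μ := by
  have hS : MemLp (∑ i, Z i) 2 μ := by
    have := memLp_finsetSum Finset.univ (f := Z) (p := 2) (μ := μ) fun i _ => hZ i
    simpa [Finset.sum_fn] using this
  have hm : ∫ ω, (∑ i, Z i) ω ∂μ = ∑ i, ∫ ω, Z i ω ∂μ := by
    simp only [Finset.sum_apply]
    exact integral_finsetSum _ fun i _ => (hZ i).integrable one_le_two
  have hv := variance_eq_integral hS.aestronglyMeasurable.aemeasurable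
  rw [hm] at hv
  simp only [Finset.sum_apply] at hv
  constructor
  · have := (hS.sub (memLp_const (∑ i, ∫ ω, Z i ω ∂μ))).integrable_sq
    simpa using this
  · rw [← hv, IndepFun.variance_sum (fun i _ => hZ i) fun i _ j _ hij => hind hij]
    exact Finset.sum_le_sum fun i _ => variance_le_expectation_sq (hZ i).aestronglyMeasurable

end Moments

/-- The first order condition at the minimum of a quadratic polynomial. -/
theorem eq_zero_of_forall_quadratic_nonneg {a b : ℝ} (h : ∀ t : ℝ, 0 ≤ -2 * t * a + t ^ 2 * b) :
    a = 0 := by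
  have hb : 0 ≤ b := by nlinarith [h 1, h (-1)]
  -- Nearly the minimiser `a / b`; the shift by one also covers `b = 0`.
  have h1 := h (a / (b + 1))
  have h2 : -2 * (a / (b + 1)) * a + (a / (b + 1)) ^ 2 * b
      = -(a ^ 2 * ((b + 2) / (b + 1) ^ 2)) := by field_simp; ring
  rw [h2] at h1
  have h3 : 0 < (b + 2) / (b + 1) ^ 2 := by positivity
  have h4 : a ^ 2 ≤ 0 := by nlinarith [sq_nonneg a]
  exact (pow_eq_zero_iff two_ne_zero).1 (le_antisymm h4 (sq_nonneg a))

/-! ### The regression model, its Gram matrix and the comparison of empirical and theoretical norms.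
-/

section Model

open Matrix

set_option linter.unusedSectionVars false

variable {Ω 𝒳 : Type*} [MeasurableSpace Ω] [MeasurableSpace 𝒳]

/-- The standing assumptions of the regression model, for a fixed sample size. -/
structure Model (μ : Measure Ω) {n p : ℕ} (X : Fin n → Ω → 𝒳) (Y : Fin n → Ω → ℝ)
    (ψ : Fin p → 𝒳 → ℝ) (K₀ : ℝ≥0) (KX : ℝ) : Prop where
  measurable_X : ∀ i, Measurable (X i)
  measurable_Y : ∀ i, Measurable (Y i)
  measurable_ψ : ∀ j, Measurable (ψ j)
  indep : iIndepFun (fun i ω => (X i ω, Y i ω)) μ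
  subGaussian : UniformlySubGaussian μ Y K₀
  bdd : ∀ᵐ ω ∂μ, ∀ i j, |ψ j (X i ω)| ≤ KX
  lambdaMin_pos : 0 < lambdaMin μ X ψ
  n_pos : 1 ≤ n
  two_le_p : 2 ≤ p

/-- The vector `(ψ_1(x), …, ψ_p(x))`. -/
def feature {p : ℕ} (ψ : Fin p → 𝒳 → ℝ) (x : 𝒳) : Fin p → ℝ := fun j => ψ j x

theorem linFun_eq {p : ℕ} (ψ : Fin p → 𝒳 → ℝ) (β : Fin p → ℝ) (x : 𝒳) :
    linFun ψ β x = feature ψ x ⬝ᵥ β := by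
  simp [linFun, feature, dotProduct, mul_comm]

variable {μ : Measure Ω} [IsProbabilityMeasure μ] {n p : ℕ} {X : Fin n → Ω → 𝒳}
  {Y : Fin n → Ω → ℝ} {ψ : Fin p → 𝒳 → ℝ} {K₀ : ℝ≥0} {KX : ℝ}

namespace Model

theorem measurable_feature (M : Model μ X Y ψ K₀ KX) : Measurable (feature ψ) :=
  measurable_pi_lambda _ M.measurable_ψ

theorem measurable_feature_comp (M : Model μ X Y ψ K₀ KX) (i : Fin n) :
    Measurable fun ω => feature ψ (X i ω) := M.measurable_feature.comp (M.measurable_X i)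

theorem measurable_linFun (M : Model μ X Y ψ K₀ KX) (β : Fin p → ℝ) :
    Measurable (linFun ψ β) :=
  Finset.measurable_sum _ fun j _ => (M.measurable_ψ j).const_mul _

theorem feature_dotProduct_le (M : Model μ X Y ψ K₀ KX) (i : Fin n) :
    ∀ᵐ ω ∂μ, feature ψ (X i ω) ⬝ᵥ feature ψ (X i ω) ≤ p * KX ^ 2 := by
  filter_upwards [M.bdd] with ω hω
  refine (Finset.sum_le_card_nsmul _ _ (KX ^ 2) fun j _ => ?_).trans (by simp)
  have := sq_le_sq' (neg_le_of_abs_le (hω i j)) (le_of_abs_le (hω i j))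
  simpa [feature, sq] using this

theorem n_cast_pos (M : Model μ X Y ψ K₀ KX) : (0 : ℝ) < n := by exact_mod_cast M.n_pos

theorem p_cast_pos (M : Model μ X Y ψ K₀ KX) : (0 : ℝ) < p := by
  have := M.two_le_p; positivity

theorem gram_eq (X : Fin n → Ω → 𝒳) (ψ : Fin p → 𝒳 → ℝ) :
    gram μ X ψ = (n : ℝ)⁻¹ • ∑ i, secondMoment μ fun ω => feature ψ (X i ω) := by
  ext j k
  simp [gram, secondMoment, feature, Matrix.sum_apply, div_eq_inv_mul]

theorem gram_isHermitian (X : Fin n → Ω → 𝒳) (ψ : Fin p → 𝒳 → ℝ) :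
    (gram μ X ψ).IsHermitian := by
  have : (gram μ X ψ)ᵀ = gram μ X ψ := by
    ext j k; simp [gram, mul_comm]
  simpa [IsHermitian] using this

theorem quadForm_gram (M : Model μ X Y ψ K₀ KX) (β : Fin p → ℝ) :
    β ⬝ᵥ gram μ X ψ *ᵥ β = theoNormSq μ fun i ω => linFun ψ β (X i ω) := by
  rw [gram_eq, smul_mulVec, dotProduct_smul, sum_mulVec, dotProduct_sum, theoNormSq,
    div_eq_inv_mul, smul_eq_mul]
  congr 1
  refine Finset.sum_congr rfl fun i _ => ?_
  rw [quadForm_secondMoment (M.measurable_feature_comp i) (M.feature_dotProduct_le i)]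
  simp only [linFun_eq]

theorem lambdaMin_sq (M : Model μ X Y ψ K₀ KX) :
    lambdaMin μ X ψ ^ 2 = minEigenvalue (gram μ X ψ) :=
  Real.sq_sqrt (Real.sqrt_pos.1 M.lambdaMin_pos).le

theorem lambdaMin_sq_le (M : Model μ X Y ψ K₀ KX) {U : Matrix (Fin p) (Fin p) ℝ} {d : Fin p → ℝ}
    (h : IsSpectral (gram μ X ψ) U d) (k : Fin p) : lambdaMin μ X ψ ^ 2 ≤ d k := by
  have hpos : 0 < minEigenvalue (gram μ X ψ) := Real.sqrt_pos.1 M.lambdaMin_pos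
  rw [M.lambdaMin_sq]
  -- An infimum over a set unbounded below has the default value `0`, which positivity of
  -- `minEigenvalue` excludes.
  have hbd : BddBelow {l : ℝ | Module.End.HasEigenvalue (Matrix.toLin' (gram μ X ψ)) l} := by
    by_contra hcon
    exact hpos.ne' (Real.sInf_of_not_bddBelow hcon)
  refine csInf_le hbd (Module.End.hasEigenvalue_of_hasEigenvector (x := U.col k) ?_)
  rw [Module.End.hasEigenvector_iff, Module.End.mem_eigenspace_iff, toLin'_apply]
  refine ⟨h.mulVec_col k, fun h0 => ?_⟩
  have := h.col_dotProduct k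
  simp [h0] at this

theorem lambdaMin_sq_mul_le (M : Model μ X Y ψ K₀ KX) (β : Fin p → ℝ) :
    lambdaMin μ X ψ ^ 2 * (β ⬝ᵥ β) ≤ theoNormSq μ fun i ω => linFun ψ β (X i ω) := by
  obtain ⟨U, d, h⟩ := exists_isSpectral (gram_isHermitian (μ := μ) X ψ)
  rw [← M.quadForm_gram, h.quadForm, h.dotProduct_self, Finset.mul_sum]
  exact Finset.sum_le_sum fun k _ =>
    mul_le_mul_of_nonneg_right (M.lambdaMin_sq_le h k) (sq_nonneg _)

/-- The bound `p K_X² / Λ_min²` on `|ψ(X_i)|²` in the geometry of the Gram matrix. -/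
noncomputable def leverage (μ : Measure Ω) (X : Fin n → Ω → 𝒳) (ψ : Fin p → 𝒳 → ℝ) (KX : ℝ) : ℝ :=
  p * KX ^ 2 / lambdaMin μ X ψ ^ 2

/-- With high probability the empirical norm dominates half of the theoretical norm on the
linear space. -/
theorem measure_exists_empNormSq_lt (M : Model μ X Y ψ K₀ KX) (q : ℕ)
    (hq : ((q : ℝ) + 1) * (leverage μ X ψ KX / n) ≤ 1 / 4) :
    μ {ω | ∃ β : Fin p → ℝ, empNormSq (fun i ω => linFun ψ β (X i ω)) ω <
        1 / 2 * theoNormSq μ fun i ω => linFun ψ β (X i ω)}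
      ≤ ENNReal.ofReal (p * (6 / 7) ^ q) := by
  obtain ⟨U, d, h⟩ := exists_isSpectral (gram_isHermitian (μ := μ) X ψ)
  have hn := M.n_cast_pos
  have hΛ : 0 < lambdaMin μ X ψ ^ 2 := pow_pos M.lambdaMin_pos 2
  have hdΛ := M.lambdaMin_sq_le h
  have hd : ∀ k, 0 < d k := fun k => hΛ.trans_le (hdΛ k)
  set s : Fin p → ℝ := fun k => (√(d k * n))⁻¹ with hs
  have hs2 : ∀ k, s k * s k = (d k * n)⁻¹ := fun k => by
    simp only [hs]
    rw [← mul_inv, Real.mul_self_sqrt (mul_pos (hd k) hn).le]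
  -- Whitening: `B` is `(n Σ)^{-1/2}` up to a rotation, so the vectors `B ψ(X_i)` have second moment
  -- matrices summing to the identity.
  set B : Matrix (Fin p) (Fin p) ℝ := diagonal s * Uᵀ with hB
  have hBv : ∀ v k, (B *ᵥ v) k = s k * (Uᵀ *ᵥ v) k := fun v k => by
    rw [hB, ← mulVec_mulVec, mulVec_diagonal]
  set x : Fin n → Ω → Fin p → ℝ := fun i ω => B *ᵥ feature ψ (X i ω) with hx
  have hmulVec : Measurable fun v : Fin p → ℝ => B *ᵥ v :=
    (Continuous.matrix_mulVec continuous_const continuous_id).measurable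
  have hxm : ∀ i, Measurable (x i) := fun i => hmulVec.comp (M.measurable_feature_comp i)
  have hind : iIndepFun x μ :=
    M.indep.comp (fun _ z => B *ᵥ feature ψ z.1)
      fun _ => hmulVec.comp (M.measurable_feature.comp measurable_fst)
  have hr : ∀ i, ∀ᵐ ω ∂μ, x i ω ⬝ᵥ x i ω ≤ leverage μ X ψ KX / n := fun i => by
    filter_upwards [M.feature_dotProduct_le i] with ω hω
    rw [h.dotProduct_self] at hω
    calc x i ω ⬝ᵥ x i ω = ∑ k, (d k * n)⁻¹ * (Uᵀ *ᵥ feature ψ (X i ω)) k ^ 2 := by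
          simp only [dotProduct, hx, hBv]
          exact Finset.sum_congr rfl fun k _ => by rw [← hs2]; ring
      _ ≤ ∑ k, (lambdaMin μ X ψ ^ 2 * n)⁻¹ * (Uᵀ *ᵥ feature ψ (X i ω)) k ^ 2 := by
          refine Finset.sum_le_sum fun k _ => mul_le_mul_of_nonneg_right ?_ (sq_nonneg _)
          exact inv_anti₀ (by positivity) (mul_le_mul_of_nonneg_right (hdΛ k) hn.le)
      _ ≤ (lambdaMin μ X ψ ^ 2 * n)⁻¹ * (p * KX ^ 2) := by
          rw [← Finset.mul_sum]
          exact mul_le_mul_of_nonneg_left hω (by positivity)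
      _ = leverage μ X ψ KX / n := by rw [leverage]; field_simp
  have hiso : ∑ i, secondMoment μ (x i) = 1 := by
    have e1 : ∀ i, secondMoment μ (x i)
        = B * secondMoment μ (fun ω => feature ψ (X i ω)) * Bᵀ := fun i =>
      secondMoment_mulVec (M.measurable_feature_comp i) (M.feature_dotProduct_le i) B
    have e2 : ∑ i, secondMoment μ (fun ω => feature ψ (X i ω)) = (n : ℝ) • gram μ X ψ := by
      rw [gram_eq, smul_smul, mul_inv_cancel₀ hn.ne', one_smul]
    simp only [e1]
    rw [← Finset.sum_mul, ← Finset.mul_sum, e2, h.eq, hB, transpose_mul, transpose_transpose,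
      diagonal_transpose]
    have e3 : diagonal s * Uᵀ * ((n : ℝ) • (U * diagonal d * Uᵀ)) * (U * diagonal s)
        = (n : ℝ) • (diagonal s * (Uᵀ * U) * diagonal d * (Uᵀ * U) * diagonal s) := by
      simp only [Matrix.mul_smul, Matrix.smul_mul, Matrix.mul_assoc]
    rw [e3, h.left, Matrix.mul_one, Matrix.mul_one, diagonal_mul_diagonal, diagonal_mul_diagonal,
      ← diagonal_smul, ← diagonal_one]
    congr 1
    funext k
    have := hs2 k
    have hdk := (hd k).ne'
    simp only [Pi.smul_apply, smul_eq_mul]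
    rw [show (n : ℝ) * (s k * d k * s k) = n * d k * (s k * s k) by ring, this]
    field_simp
  refine (measure_mono ?_).trans (by
    simpa only [Fintype.card_fin] using measure_exists_quadForm_lt hxm hind hr hiso q hq)
  rintro ω ⟨β, hβ⟩
  -- The coefficients in whitened coordinates: the squared length of this vector is `‖f_β‖²`, and
  -- its inner product with `x i` is `f_β(X_i) / √n`.
  refine ⟨fun k => √(d k) * (Uᵀ *ᵥ β) k, ?_⟩
  have e1 : (fun k => √(d k) * (Uᵀ *ᵥ β) k) ⬝ᵥ (fun k => √(d k) * (Uᵀ *ᵥ β) k)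
      = theoNormSq μ fun i ω => linFun ψ β (X i ω) := by
    rw [← M.quadForm_gram, h.quadForm]
    refine Finset.sum_congr rfl fun k _ => ?_
    change √(d k) * (Uᵀ *ᵥ β) k * (√(d k) * (Uᵀ *ᵥ β) k) = _
    rw [mul_mul_mul_comm, Real.mul_self_sqrt (hd k).le, sq]
  have e2 : ∀ i, (x i ω ⬝ᵥ fun k => √(d k) * (Uᵀ *ᵥ β) k) = (√n)⁻¹ * linFun ψ β (X i ω) := by
    intro i
    have : linFun ψ β (X i ω)
        = (Uᵀ *ᵥ feature ψ (X i ω)) ⬝ᵥ (Uᵀ *ᵥ β) := by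
      rw [linFun_eq, dotProduct_mulVec, vecMul_transpose, mulVec_mulVec, h.right, one_mulVec]
    rw [this, dotProduct, dotProduct, Finset.mul_sum]
    refine Finset.sum_congr rfl fun k _ => ?_
    simp only [hx, hBv, hs]
    rw [Real.sqrt_mul (hd k).le]
    have := (Real.sqrt_pos.2 (hd k)).ne'
    field_simp
  rw [e1]
  refine lt_of_eq_of_lt ?_ hβ
  simp only [e2, mul_pow, empNormSq]
  rw [← Finset.mul_sum, inv_pow, Real.sq_sqrt hn.le, div_eq_inv_mul]

end Model

end Model

/-! ### Orthogonality of the projection residuals, moments of the score and the deterministic error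
bound. -/

section Projection

open Matrix

set_option linter.unusedSectionVars false

variable {Ω 𝒳 : Type*} [MeasurableSpace Ω] [MeasurableSpace 𝒳]
  {μ : Measure Ω} [IsProbabilityMeasure μ] {n p : ℕ} {X : Fin n → Ω → 𝒳}
  {Y : Fin n → Ω → ℝ} {ψ : Fin p → 𝒳 → ℝ} {K₀ : ℝ≥0} {KX : ℝ}

theorem linFun_add_smul (ψ : Fin p → 𝒳 → ℝ) (β γ : Fin p → ℝ) (t : ℝ) (x : 𝒳) :
    linFun ψ (β + t • γ) x = linFun ψ β x + t * linFun ψ γ x := by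
  simp only [linFun_eq, dotProduct_add, dotProduct_smul, smul_eq_mul]

theorem linFun_sub (ψ : Fin p → 𝒳 → ℝ) (β γ : Fin p → ℝ) :
    linFun ψ β - linFun ψ γ = linFun ψ (β - γ) := by
  funext x
  simp only [Pi.sub_apply, linFun_eq, dotProduct_sub]

theorem dotProduct_sq_le {ι : Type*} [Fintype ι] (x y : ι → ℝ) :
    (x ⬝ᵥ y) ^ 2 ≤ (x ⬝ᵥ x) * (y ⬝ᵥ y) := by
  have := Finset.sum_mul_sq_le_sq_mul_sq Finset.univ x y
  simpa [dotProduct, sq] using this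

/-- Expansion of the square in the theoretical norm. -/
theorem theoNormSq_sub_smul {A G : Fin n → Ω → ℝ} (hA : ∀ i, MemLp (A i) 2 μ)
    (hG : ∀ i, MemLp (G i) 2 μ) (t : ℝ) :
    theoNormSq μ (fun i ω => A i ω - t * G i ω) = theoNormSq μ A
      - 2 * t * ((∑ i, ∫ ω, A i ω * G i ω ∂μ) / n) + t ^ 2 * theoNormSq μ G := by
  have h : ∀ i, ∫ ω, (A i ω - t * G i ω) ^ 2 ∂μ
      = ∫ ω, A i ω ^ 2 ∂μ - 2 * t * ∫ ω, A i ω * G i ω ∂μ + t ^ 2 * ∫ ω, G i ω ^ 2 ∂μ := fun i => by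
    have i1 := (hA i).integrable_sq
    have i2 := (hG i).integrable_sq
    have i3 : Integrable (fun ω => A i ω * G i ω) μ := (hA i).integrable_mul (hG i)
    have i4 : Integrable (fun ω => A i ω ^ 2 - 2 * t * (A i ω * G i ω)) μ :=
      i1.sub (i3.const_mul _)
    rw [← integral_const_mul, ← integral_const_mul, ← integral_sub i1 (i3.const_mul _),
      ← integral_add i4 (i2.const_mul _)]
    exact integral_congr_ae (ae_of_all _ fun ω => by ring)
  simp only [theoNormSq, h, Finset.sum_add_distrib, Finset.sum_sub_distrib, ← Finset.mul_sum]
  ring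

theorem theoNormSq_nonneg (Z : Fin n → Ω → ℝ) : 0 ≤ theoNormSq μ Z :=
  div_nonneg (Finset.sum_nonneg fun _ _ => integral_nonneg fun _ => sq_nonneg _)
    (Nat.cast_nonneg _)

namespace Model

theorem linFun_sq_le (M : Model μ X Y ψ K₀ KX) (β : Fin p → ℝ) (i : Fin n) :
    ∀ᵐ ω ∂μ, linFun ψ β (X i ω) ^ 2 ≤ p * KX ^ 2 * (β ⬝ᵥ β) := by
  filter_upwards [M.feature_dotProduct_le i] with ω hω
  rw [linFun_eq]
  exact (dotProduct_sq_le _ _).trans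
    (mul_le_mul_of_nonneg_right hω (Finset.sum_nonneg fun _ _ => mul_self_nonneg _))

theorem leverage_nonneg (X : Fin n → Ω → 𝒳) (ψ : Fin p → 𝒳 → ℝ) (KX : ℝ) :
    0 ≤ leverage μ X ψ KX := by
  unfold leverage; positivity

/-- Cauchy–Schwarz bounds `f_β(X_i)²` by `p K_X² |β|²`, and `Λ_min² |β|² ≤ ‖f_β‖²`. This sup-norm
bound controls the fourth moment of `f*`. -/
theorem linFun_sq_le_leverage (M : Model μ X Y ψ K₀ KX) (β : Fin p → ℝ) (i : Fin n) :
    ∀ᵐ ω ∂μ, linFun ψ β (X i ω) ^ 2 ≤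
      leverage μ X ψ KX * theoNormSq μ fun i ω => linFun ψ β (X i ω) := by
  have hΛ : 0 < lambdaMin μ X ψ ^ 2 := pow_pos M.lambdaMin_pos 2
  filter_upwards [M.linFun_sq_le β i] with ω hω
  refine hω.trans ?_
  calc p * KX ^ 2 * (β ⬝ᵥ β) = leverage μ X ψ KX * (lambdaMin μ X ψ ^ 2 * (β ⬝ᵥ β)) := by
        rw [leverage, div_mul_eq_mul_div, mul_left_comm, mul_div_cancel_left₀ _ hΛ.ne']
    _ ≤ _ := mul_le_mul_of_nonneg_left (M.lambdaMin_sq_mul_le β) (leverage_nonneg X ψ KX)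

theorem memLp_linFun (M : Model μ X Y ψ K₀ KX) (β : Fin p → ℝ) (i : Fin n) (q : ℝ≥0∞) :
    MemLp (fun ω => linFun ψ β (X i ω)) q μ :=
  MemLp.of_bound ((M.measurable_linFun β).comp (M.measurable_X i)).aestronglyMeasurable
    (√(p * KX ^ 2 * (β ⬝ᵥ β))) (by
      filter_upwards [M.linFun_sq_le β i] with ω hω
      exact Real.abs_le_sqrt hω)

/-- The first unit vector as `β` gives `Λ_min² ≤ ‖ψ_1‖² ≤ p K_X²`. It lets terms without the
leverage factor be absorbed into terms with it. -/
theorem one_le_leverage (M : Model μ X Y ψ K₀ KX) : 1 ≤ leverage μ X ψ KX := by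
  have hΛ : 0 < lambdaMin μ X ψ ^ 2 := pow_pos M.lambdaMin_pos 2
  have hn := M.n_cast_pos
  let β : Fin p → ℝ := Pi.single ⟨0, by have := M.two_le_p; omega⟩ 1
  have hβ : β ⬝ᵥ β = 1 := by simp [β]
  have h1 := M.lambdaMin_sq_mul_le β
  have h2 : theoNormSq μ (fun i ω => linFun ψ β (X i ω)) ≤ p * KX ^ 2 := by
    rw [theoNormSq, div_le_iff₀ hn]
    refine (Finset.sum_le_card_nsmul _ _ (p * KX ^ 2) fun i _ => ?_).trans
      (by simp [mul_comm])
    have h3 := integral_mono_ae (M.memLp_linFun β i 2).integrable_sq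
      (integrable_const (p * KX ^ 2 * (β ⬝ᵥ β))) (M.linFun_sq_le β i)
    simpa [hβ] using h3
  rw [hβ, mul_one] at h1
  rw [leverage, le_div_iff₀ hΛ]
  linarith

/-- Twice `1 + K₀²`, a bound for the second moments of the responses. -/
noncomputable def respBound (K₀ : ℝ≥0) : ℝ := 2 * (1 + (K₀ : ℝ) ^ 2)

theorem respBound_pos (K₀ : ℝ≥0) : 0 < respBound K₀ := by unfold respBound; positivity

theorem memLp_Y (M : Model μ X Y ψ K₀ KX) (i : Fin n) : MemLp (Y i) 2 μ :=
  (moments_of_psi2Norm_le (M.measurable_Y i) (M.subGaussian i)).1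

theorem theoNormSq_Y_le (M : Model μ X Y ψ K₀ KX) : theoNormSq μ Y ≤ respBound K₀ := by
  rw [theoNormSq, div_le_iff₀ M.n_cast_pos]
  refine (Finset.sum_le_card_nsmul _ _ (respBound K₀) fun i _ => ?_).trans
    (by simp [mul_comm])
  exact (moments_of_psi2Norm_le (M.measurable_Y i) (M.subGaussian i)).2.2.1

/-- `f_β(X_i)` is measurable with respect to `X_i`, so it can be pulled out of the conditional
expectation. Hence projecting `f⁰` also projects `Y`. -/
theorem integral_regression_mul (M : Model μ X Y ψ K₀ KX) (β : Fin p → ℝ) (i : Fin n) :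
    ∫ ω, regression μ X Y i ω * linFun ψ β (X i ω) ∂μ
      = ∫ ω, Y i ω * linFun ψ β (X i ω) ∂μ := by
  have hm := (M.measurable_X i).comap_le
  have hG : StronglyMeasurable[MeasurableSpace.comap (X i) inferInstance]
      (fun ω => linFun ψ β (X i ω)) :=
    ((M.measurable_linFun β).comp (comap_measurable (X i))).stronglyMeasurable
  have h := condExp_mul_of_stronglyMeasurable_right (μ := μ) hG
    ((M.memLp_Y i).integrable_mul (M.memLp_linFun β i 2)) ((M.memLp_Y i).integrable one_le_two)
  have h2 := integral_condExp (μ := μ) (f := Y i * fun ω => linFun ψ β (X i ω)) hm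
  rw [integral_congr_ae h] at h2
  exact h2

/-- The residuals of the projection are orthogonal to the linear space. -/
theorem projection_orthogonal (M : Model μ X Y ψ K₀ KX) {βs : Fin p → ℝ}
    (h : IsProjection μ X Y ψ (linFun ψ βs)) (β : Fin p → ℝ) :
    ∑ i, ∫ ω, (Y i ω - linFun ψ βs (X i ω)) * linFun ψ β (X i ω) ∂μ = 0 := by
  have hn := M.n_cast_pos
  have hR : ∀ i, MemLp (regression μ X Y i) 2 μ := fun i => (M.memLp_Y i).condExp one_le_two
  have hA : ∀ i, MemLp (fun ω => regression μ X Y i ω - linFun ψ βs (X i ω)) 2 μ := fun i =>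
    (hR i).sub (M.memLp_linFun βs i 2)
  have hG : ∀ i, MemLp (fun ω => linFun ψ β (X i ω)) 2 μ := fun i => M.memLp_linFun β i 2
  have h1 : (∑ i, ∫ ω, (regression μ X Y i ω - linFun ψ βs (X i ω)) *
      linFun ψ β (X i ω) ∂μ) / n = 0 := by
    refine eq_zero_of_forall_quadratic_nonneg
      (b := theoNormSq μ fun i ω => linFun ψ β (X i ω)) fun t => ?_
    have h2 := h.2 (linFun ψ (βs + t • β)) ⟨_, rfl⟩
    have h3 : (fun i ω => regression μ X Y i ω - linFun ψ (βs + t • β) (X i ω))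
        = fun (i : Fin n) ω => (regression μ X Y i ω - linFun ψ βs (X i ω))
          - t * linFun ψ β (X i ω) := by
      funext i ω; rw [linFun_add_smul]; ring
    rw [h3, theoNormSq_sub_smul hA hG] at h2
    linarith
  have h4 : ∀ i, ∫ ω, (Y i ω - linFun ψ βs (X i ω)) * linFun ψ β (X i ω) ∂μ
      = ∫ ω, (regression μ X Y i ω - linFun ψ βs (X i ω)) * linFun ψ β (X i ω) ∂μ := fun i => by
    have iF : Integrable (fun ω => linFun ψ βs (X i ω) * linFun ψ β (X i ω)) μ :=
      (M.memLp_linFun βs i 2).integrable_mul (hG i)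
    have iY : Integrable (fun ω => Y i ω * linFun ψ β (X i ω)) μ :=
      (M.memLp_Y i).integrable_mul (hG i)
    have iR : Integrable (fun ω => regression μ X Y i ω * linFun ψ β (X i ω)) μ :=
      (hR i).integrable_mul (hG i)
    simp only [sub_mul]
    rw [integral_sub iY iF, integral_sub iR iF, M.integral_regression_mul]
  simp only [h4]
  exact (div_eq_zero_iff.1 h1).resolve_right hn.ne'

theorem memLp_resid (M : Model μ X Y ψ K₀ KX) (βs : Fin p → ℝ) (i : Fin n) :
    MemLp (fun ω => Y i ω - linFun ψ βs (X i ω)) 2 μ :=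
  (M.memLp_Y i).sub (M.memLp_linFun βs i 2)

theorem projection_pythagoras (M : Model μ X Y ψ K₀ KX) {βs : Fin p → ℝ}
    (h : IsProjection μ X Y ψ (linFun ψ βs)) :
    theoNormSq μ (fun i ω => Y i ω - linFun ψ βs (X i ω))
      + theoNormSq μ (fun i ω => linFun ψ βs (X i ω)) = theoNormSq μ Y := by
  -- The choice `t = -1` adds `f*` back to the residual and recovers `Y`.
  have h1 := theoNormSq_sub_smul (M.memLp_resid βs) (fun i => M.memLp_linFun βs i 2) (-1)
  rw [M.projection_orthogonal h βs] at h1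
  have h2 : (fun i ω => Y i ω - linFun ψ βs (X i ω) - -1 * linFun ψ βs (X i ω)) = Y := by
    funext i ω; ring
  rw [h2] at h1
  rw [h1]; ring

theorem theoNormSq_resid_le (M : Model μ X Y ψ K₀ KX) {βs : Fin p → ℝ}
    (h : IsProjection μ X Y ψ (linFun ψ βs)) :
    theoNormSq μ (fun i ω => Y i ω - linFun ψ βs (X i ω)) ≤ respBound K₀ := by
  linarith [M.projection_pythagoras h, M.theoNormSq_Y_le,
    theoNormSq_nonneg (μ := μ) fun i ω => linFun ψ βs (X i ω)]

theorem theoNormSq_projection_le (M : Model μ X Y ψ K₀ KX) {βs : Fin p → ℝ}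
    (h : IsProjection μ X Y ψ (linFun ψ βs)) :
    theoNormSq μ (fun i ω => linFun ψ βs (X i ω)) ≤ respBound K₀ := by
  linarith [M.projection_pythagoras h, M.theoNormSq_Y_le,
    theoNormSq_nonneg (μ := μ) fun i ω => Y i ω - linFun ψ βs (X i ω)]

/-- The score vector `n⁻¹ ∑ ε_i ψ(X_i)`, where `ε_i = Y_i - f_β(X_i)`. -/
noncomputable def score (X : Fin n → Ω → 𝒳) (Y : Fin n → Ω → ℝ) (ψ : Fin p → 𝒳 → ℝ)
    (βs : Fin p → ℝ) (ω : Ω) : Fin p → ℝ :=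
  fun j => (∑ i, (Y i ω - linFun ψ βs (X i ω)) * ψ j (X i ω)) / n

theorem linFun_single (ψ : Fin p → 𝒳 → ℝ) (j : Fin p) (x : 𝒳) :
    linFun ψ (Pi.single j 1) x = ψ j x := by
  rw [linFun_eq]; simp [feature]

theorem score_sq_integral (M : Model μ X Y ψ K₀ KX) {βs : Fin p → ℝ}
    (h : IsProjection μ X Y ψ (linFun ψ βs)) (j : Fin p) :
    Integrable (fun ω => score X Y ψ βs ω j ^ 2) μ ∧
      ∫ ω, score X Y ψ βs ω j ^ 2 ∂μ ≤ respBound K₀ * KX ^ 2 / n := by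
  have hn := M.n_cast_pos
  set Z : Fin n → Ω → ℝ := fun i ω => (Y i ω - linFun ψ βs (X i ω)) * ψ j (X i ω) with hZ
  have hbd : ∀ i, ∀ᵐ ω ∂μ, |ψ j (X i ω)| ≤ KX := fun i => by
    filter_upwards [M.bdd] with ω hω using hω i j
  have hle : ∀ i, ∀ᵐ ω ∂μ, Z i ω ^ 2 ≤ KX ^ 2 * (Y i ω - linFun ψ βs (X i ω)) ^ 2 := fun i => by
    filter_upwards [hbd i] with ω hω
    have := sq_le_sq' (neg_le_of_abs_le hω) (le_of_abs_le hω)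
    simp only [hZ, mul_pow]
    rw [mul_comm]
    exact mul_le_mul_of_nonneg_right this (sq_nonneg _)
  have hZm : ∀ i, Measurable (Z i) := fun i =>
    ((M.measurable_Y i).sub ((M.measurable_linFun βs).comp (M.measurable_X i))).mul
      ((M.measurable_ψ j).comp (M.measurable_X i))
  have hZ2 : ∀ i, Integrable (fun ω => Z i ω ^ 2) μ := fun i => by
    refine ((M.memLp_resid βs i).integrable_sq.const_mul (KX ^ 2)).mono'
      ((hZm i).pow_const 2).aestronglyMeasurable ?_
    filter_upwards [hle i] with ω hω
    rwa [Real.norm_eq_abs, abs_of_nonneg (sq_nonneg _)]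
  have hZL : ∀ i, MemLp (Z i) 2 μ := fun i =>
    (memLp_two_iff_integrable_sq (hZm i).aestronglyMeasurable).2 (hZ2 i)
  have hind : iIndepFun Z μ := M.indep.comp
    (fun _ z => (z.2 - linFun ψ βs z.1) * ψ j z.1) fun _ =>
      (measurable_snd.sub ((M.measurable_linFun βs).comp measurable_fst)).mul
        ((M.measurable_ψ j).comp measurable_fst)
  obtain ⟨c1, c2⟩ := integral_sq_centered_sum_le hZL fun i k hik => hind.indepFun hik
  -- Under misspecification the individual `Z i` need not be centred; only the sum of their means
  -- vanishes, which suffices.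
  have h0 : ∑ i, ∫ ω, Z i ω ∂μ = 0 := by
    have := M.projection_orthogonal h (Pi.single j 1)
    simpa only [linFun_single] using this
  rw [h0] at c1 c2
  simp only [sub_zero] at c1 c2
  have e : (fun ω => score X Y ψ βs ω j ^ 2) = fun ω => (∑ i, Z i ω) ^ 2 / (n : ℝ) ^ 2 := by
    funext ω; simp only [score, div_pow, hZ]
  rw [e]
  refine ⟨c1.div_const _, ?_⟩
  rw [integral_div]
  have c3 : ∑ i, ∫ ω, Z i ω ^ 2 ∂μ ≤ KX ^ 2 * (n * respBound K₀) := by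
    have hr := M.theoNormSq_resid_le h
    rw [theoNormSq, div_le_iff₀' hn] at hr
    refine le_trans ?_ (mul_le_mul_of_nonneg_left hr (sq_nonneg KX))
    rw [Finset.mul_sum]
    refine Finset.sum_le_sum fun i _ => ?_
    rw [← integral_const_mul]
    exact integral_mono_ae (hZ2 i) ((M.memLp_resid βs i).integrable_sq.const_mul _) (hle i)
  rw [div_le_div_iff₀ (by positivity) hn]
  nlinarith [mul_le_mul_of_nonneg_right (c2.trans c3) hn.le]

theorem score_dotProduct_integral (M : Model μ X Y ψ K₀ KX) {βs : Fin p → ℝ}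
    (h : IsProjection μ X Y ψ (linFun ψ βs)) :
    Integrable (fun ω => score X Y ψ βs ω ⬝ᵥ score X Y ψ βs ω) μ ∧
      ∫ ω, score X Y ψ βs ω ⬝ᵥ score X Y ψ βs ω ∂μ
        ≤ respBound K₀ * (p * KX ^ 2) / n := by
  simp only [dotProduct, ← sq]
  refine ⟨integrable_finsetSum _ fun j _ => (M.score_sq_integral h j).1, ?_⟩
  rw [integral_finsetSum _ fun j _ => (M.score_sq_integral h j).1]
  refine (Finset.sum_le_card_nsmul _ _ _ fun j _ => (M.score_sq_integral h j).2).trans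
    (le_of_eq ?_)
  simp only [Finset.card_univ, Fintype.card_fin, nsmul_eq_mul]
  ring

/-- Second moment of the fluctuation of the empirical risk at the projection. -/
theorem empNormSq_resid_sub_integral (M : Model μ X Y ψ K₀ KX) {βs : Fin p → ℝ}
    (h : IsProjection μ X Y ψ (linFun ψ βs)) :
    Integrable (fun ω => (empNormSq (fun i ω => Y i ω - linFun ψ βs (X i ω)) ω
      - theoNormSq μ fun i ω => Y i ω - linFun ψ βs (X i ω)) ^ 2) μ ∧
    ∫ ω, (empNormSq (fun i ω => Y i ω - linFun ψ βs (X i ω)) ω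
      - theoNormSq μ fun i ω => Y i ω - linFun ψ βs (X i ω)) ^ 2 ∂μ
      ≤ 24 * respBound K₀ ^ 2 * leverage μ X ψ KX / n := by
  have hn := M.n_cast_pos
  have hT := respBound_pos K₀
  set L := leverage μ X ψ KX with hL
  have hL1 : 1 ≤ L := M.one_le_leverage
  set F : Fin n → Ω → ℝ := fun i ω => linFun ψ βs (X i ω) with hF
  set e : Fin n → Ω → ℝ := fun i ω => Y i ω - F i ω with he
  have hFm : ∀ i, Measurable (F i) := fun i => (M.measurable_linFun βs).comp (M.measurable_X i)
  have hem : ∀ i, Measurable (e i) := fun i => (M.measurable_Y i).sub (hFm i)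
  have mY := fun i => moments_of_psi2Norm_le (M.measurable_Y i) (M.subGaussian i)
  have hFT := M.theoNormSq_projection_le h
  -- One factor `f*²` is bounded by its supremum; the other is kept so that averaging over `i`
  -- produces `‖f*‖²`.
  have hF4 : ∀ i, ∀ᵐ ω ∂μ, F i ω ^ 4 ≤ L * respBound K₀ * F i ω ^ 2 := fun i => by
    filter_upwards [M.linFun_sq_le_leverage βs i] with ω hω
    have h1 : F i ω ^ 2 ≤ L * respBound K₀ :=
      hω.trans (mul_le_mul_of_nonneg_left hFT (by linarith))
    nlinarith [mul_le_mul_of_nonneg_right h1 (sq_nonneg (F i ω))]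
  have iF2 : ∀ i, Integrable (fun ω => F i ω ^ 2) μ := fun i => (M.memLp_linFun βs i 2).integrable_sq
  have hdom : ∀ i, ∀ᵐ ω ∂μ, (e i ω ^ 2) ^ 2
      ≤ 8 * Y i ω ^ 4 + 8 * (L * respBound K₀ * F i ω ^ 2) := fun i => by
    filter_upwards [hF4 i] with ω hω
    have h1 : e i ω ^ 2 ≤ 2 * (Y i ω ^ 2 + F i ω ^ 2) := by
      simp only [he]; nlinarith [sq_nonneg (Y i ω + F i ω)]
    have h2 : (e i ω ^ 2) ^ 2 ≤ (2 * (Y i ω ^ 2 + F i ω ^ 2)) ^ 2 :=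
      pow_le_pow_left₀ (sq_nonneg _) h1 2
    nlinarith [sq_nonneg (Y i ω ^ 2 - F i ω ^ 2)]
  have idom : ∀ i, Integrable (fun ω => 8 * Y i ω ^ 4 + 8 * (L * respBound K₀ * F i ω ^ 2)) μ :=
    fun i => ((mY i).2.1.const_mul 8).add (((iF2 i).const_mul _).const_mul 8)
  have ie4 : ∀ i, Integrable (fun ω => (e i ω ^ 2) ^ 2) μ := fun i => by
    refine (idom i).mono' (((hem i).pow_const 2).pow_const 2).aestronglyMeasurable ?_
    filter_upwards [hdom i] with ω hω
    rwa [Real.norm_eq_abs, abs_of_nonneg (sq_nonneg _)]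
  have heL : ∀ i, MemLp (fun ω => e i ω ^ 2) 2 μ := fun i =>
    (memLp_two_iff_integrable_sq ((hem i).pow_const 2).aestronglyMeasurable).2 (ie4 i)
  have hind : iIndepFun (fun i ω => e i ω ^ 2) μ := M.indep.comp
    (fun _ z => (z.2 - linFun ψ βs z.1) ^ 2) fun _ =>
      (measurable_snd.sub ((M.measurable_linFun βs).comp measurable_fst)).pow_const 2
  obtain ⟨c1, c2⟩ := integral_sq_centered_sum_le heL fun i k hik => hind.indepFun hik
  have heq : (fun ω => (empNormSq e ω - theoNormSq μ e) ^ 2)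
      = fun ω => (∑ i, e i ω ^ 2 - ∑ i, ∫ ω, e i ω ^ 2 ∂μ) ^ 2 / (n : ℝ) ^ 2 := by
    funext ω; rw [empNormSq, theoNormSq, ← sub_div, div_pow]
  change Integrable (fun ω => (empNormSq e ω - theoNormSq μ e) ^ 2) μ ∧
    ∫ ω, (empNormSq e ω - theoNormSq μ e) ^ 2 ∂μ ≤ _
  rw [heq]
  refine ⟨c1.div_const _, ?_⟩
  rw [integral_div]
  -- With `T = respBound K₀`, the term `8 E Y⁴` contributes `16 T²` and `8 E f*⁴` contributes on
  -- average `8 L T²`; `L ≥ 1` merges them into `24 T² L`.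
  have c3 : ∑ i, ∫ ω, (e i ω ^ 2) ^ 2 ∂μ ≤ n * (24 * respBound K₀ ^ 2 * L) := by
    have h1 : ∀ i, ∫ ω, (e i ω ^ 2) ^ 2 ∂μ
        ≤ 16 * respBound K₀ ^ 2 + 8 * (L * respBound K₀) * ∫ ω, F i ω ^ 2 ∂μ := fun i => by
      refine (integral_mono_ae (ie4 i) (idom i) (hdom i)).trans ?_
      rw [integral_add ((mY i).2.1.const_mul 8) (((iF2 i).const_mul _).const_mul 8)]
      simp only [integral_const_mul]
      have := (mY i).2.2.2
      simp only [respBound] at *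
      linarith
    have h2 : ∑ i, ∫ ω, F i ω ^ 2 ∂μ ≤ n * respBound K₀ := by
      have := hFT
      rwa [theoNormSq, div_le_iff₀' hn] at this
    calc ∑ i, ∫ ω, (e i ω ^ 2) ^ 2 ∂μ
        ≤ ∑ i, (16 * respBound K₀ ^ 2 + 8 * (L * respBound K₀) * ∫ ω, F i ω ^ 2 ∂μ) :=
          Finset.sum_le_sum fun i _ => h1 i
      _ = n * (16 * respBound K₀ ^ 2) + 8 * (L * respBound K₀) * ∑ i, ∫ ω, F i ω ^ 2 ∂μ := by
          rw [Finset.sum_add_distrib, Finset.mul_sum, Finset.sum_const, Finset.card_univ,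
            Fintype.card_fin, nsmul_eq_mul]
      _ ≤ n * (16 * respBound K₀ ^ 2) + 8 * (L * respBound K₀) * (n * respBound K₀) := by
          gcongr
      _ ≤ n * (24 * respBound K₀ ^ 2 * L) := by
          have : 0 ≤ n * respBound K₀ ^ 2 * (L - 1) :=
            mul_nonneg (by positivity) (by linarith)
          nlinarith
  rw [div_le_div_iff₀ (by positivity) hn]
  nlinarith [mul_le_mul_of_nonneg_right (c2.trans c3) hn.le]

/-- Deterministic comparison of a least squares fit with `f_β`, on the event where the empirical
norm dominates half of the theoretical norm. -/
theorem fit_bounds (M : Model μ X Y ψ K₀ KX) {ω : Ω} {βh βs : Fin p → ℝ}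
    (hfit : IsLeastSquaresFit X Y ψ ω (linFun ψ βh))
    (hiso : 1 / 2 * theoNormSq μ (fun i ω => linFun ψ (βh - βs) (X i ω))
      ≤ empNormSq (fun i ω => linFun ψ (βh - βs) (X i ω)) ω) :
    theoNormSq μ (fun i ω => linFun ψ (βh - βs) (X i ω))
      ≤ 4 * (score X Y ψ βs ω ⬝ᵥ score X Y ψ βs ω / lambdaMin μ X ψ ^ 2) ∧
    |empNormSq (fun i ω => Y i ω - linFun ψ βh (X i ω)) ω
      - empNormSq (fun i ω => Y i ω - linFun ψ βs (X i ω)) ω|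
      ≤ 2 * (score X Y ψ βs ω ⬝ᵥ score X Y ψ βs ω / lambdaMin μ X ψ ^ 2) := by
  have hn := M.n_cast_pos
  have hΛ : 0 < lambdaMin μ X ψ ^ 2 := pow_pos M.lambdaMin_pos 2
  set b := βh - βs with hb
  set g : Fin n → ℝ := fun i => linFun ψ b (X i ω) with hg
  set V := score X Y ψ βs ω ⬝ᵥ score X Y ψ βs ω with hV
  set N := theoNormSq μ fun i ω => linFun ψ b (X i ω) with hN
  have hhs : ∀ i, linFun ψ βh (X i ω) = linFun ψ βs (X i ω) + g i := fun i => by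
    have := congrFun (linFun_sub ψ βh βs) (X i ω)
    simp only [Pi.sub_apply] at this
    simp only [hg, hb]; linarith
  -- The normal equation in the direction `f̂ - f*`.
  have horth : ∑ i, (Y i ω - linFun ψ βh (X i ω)) * g i = 0 := by
    refine eq_zero_of_forall_quadratic_nonneg (b := ∑ i, g i ^ 2) fun t => ?_
    have h2 := hfit.2 (linFun ψ (βh + t • b)) ⟨_, rfl⟩
    have h3 : ∑ i, (Y i ω - linFun ψ (βh + t • b) (X i ω)) ^ 2
        = ∑ i, (Y i ω - linFun ψ βh (X i ω)) ^ 2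
          + (-2 * t * ∑ i, (Y i ω - linFun ψ βh (X i ω)) * g i + t ^ 2 * ∑ i, g i ^ 2) := by
      rw [Finset.mul_sum, Finset.mul_sum, ← Finset.sum_add_distrib, ← Finset.sum_add_distrib]
      refine Finset.sum_congr rfl fun i _ => ?_
      rw [linFun_add_smul]; simp only [hg]; ring
    linarith
  set s := (∑ i, g i ^ 2) / n with hs
  have hse : empNormSq (fun i ω => linFun ψ b (X i ω)) ω = s := rfl
  have hsb : s = b ⬝ᵥ score X Y ψ βs ω := by
    have h1 : ∑ i, g i ^ 2 = ∑ i, (Y i ω - linFun ψ βs (X i ω)) * g i := by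
      rw [← sub_eq_zero, ← neg_eq_zero, ← horth, ← Finset.sum_sub_distrib,
        ← Finset.sum_neg_distrib]
      exact Finset.sum_congr rfl fun i _ => by rw [hhs i]; ring
    rw [hs, h1]
    simp only [dotProduct, score, hg, linFun, Finset.mul_sum]
    rw [Finset.sum_comm, Finset.sum_div]
    refine Finset.sum_congr rfl fun j _ => ?_
    rw [mul_div_assoc', Finset.mul_sum]
    congr 1
    exact Finset.sum_congr rfl fun i _ => by ring
  have hs0 : 0 ≤ s := div_nonneg (Finset.sum_nonneg fun _ _ => sq_nonneg _) hn.le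
  have hV0 : 0 ≤ V := Finset.sum_nonneg fun _ _ => mul_self_nonneg _
  have hNs : N ≤ 2 * s := by rw [hse] at hiso; linarith
  -- A self-bounding inequality: `|b|²` is controlled by the theoretical norm, and this in turn by
  -- `2 s` through the norm comparison, so one factor `s` cancels.
  have hkey : s ^ 2 ≤ 2 * s * (V / lambdaMin μ X ψ ^ 2) := by
    have h1 : s ^ 2 ≤ (b ⬝ᵥ b) * V := by rw [hsb]; exact dotProduct_sq_le _ _
    have h2 : b ⬝ᵥ b ≤ N / lambdaMin μ X ψ ^ 2 := by
      rw [le_div_iff₀' hΛ]; exact M.lambdaMin_sq_mul_le b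
    calc s ^ 2 ≤ N / lambdaMin μ X ψ ^ 2 * V := h1.trans (mul_le_mul_of_nonneg_right h2 hV0)
      _ = N * (V / lambdaMin μ X ψ ^ 2) := by ring
      _ ≤ _ := mul_le_mul_of_nonneg_right hNs (div_nonneg hV0 hΛ.le)
  have hsV : s ≤ 2 * (V / lambdaMin μ X ψ ^ 2) := by
    rcases hs0.eq_or_lt with h0 | h0
    · rw [← h0]; exact mul_nonneg zero_le_two (div_nonneg hV0 hΛ.le)
    · refine le_of_mul_le_mul_left ?_ h0
      linarith
  refine ⟨by linarith, ?_⟩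
  have hdiff : empNormSq (fun i ω => Y i ω - linFun ψ βh (X i ω)) ω
      - empNormSq (fun i ω => Y i ω - linFun ψ βs (X i ω)) ω = -s := by
    simp only [empNormSq]
    rw [← sub_div, hs, ← neg_div]
    congr 1
    have h1 : ∑ i, (Y i ω - linFun ψ βh (X i ω)) ^ 2 - ∑ i, (Y i ω - linFun ψ βs (X i ω)) ^ 2
        = -∑ i, g i ^ 2 - 2 * ∑ i, (Y i ω - linFun ψ βh (X i ω)) * g i := by
      rw [Finset.mul_sum, ← Finset.sum_neg_distrib, ← Finset.sum_sub_distrib,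
        ← Finset.sum_sub_distrib]
      exact Finset.sum_congr rfl fun i _ => by rw [hhs i]; ring
    rw [h1, horth]; ring
  rw [hdiff, abs_neg, abs_of_nonneg hs0]
  exact hsV

end Model

end Projection

/-! ### Translation of the moment and tail bounds into the rate `δ_n`. -/

section Rate

open Matrix

set_option linter.unusedSectionVars false

variable {Ω 𝒳 : Type*} [MeasurableSpace Ω] [MeasurableSpace 𝒳]
  {μ : Measure Ω} [IsProbabilityMeasure μ] {n p : ℕ} {X : Fin n → Ω → 𝒳}
  {Y : Fin n → Ω → ℝ} {ψ : Fin p → 𝒳 → ℝ} {K₀ : ℝ≥0} {KX : ℝ}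

namespace Model

/-- Since `p ≥ 2`, constants can be paid for by multiples of `log p`. -/
theorem half_le_log (M : Model μ X Y ψ K₀ KX) : 1 / 2 ≤ Real.log p := by
  have h2 : (2 : ℝ) ≤ p := by exact_mod_cast M.two_le_p
  have := Real.log_le_log (by norm_num) h2
  linarith [Real.log_two_gt_d9]

theorem rate_sq (M : Model μ X Y ψ K₀ KX) :
    rate n p KX K₀ (lambdaMin μ X ψ) ^ 2
      = respBound K₀ / 2 * (leverage μ X ψ KX / n) * Real.log p := by
  have hlog : 0 ≤ Real.log p := by linarith [M.half_le_log]
  rw [rate, Real.sq_sqrt (by positivity), respBound, leverage]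
  have := M.lambdaMin_pos.ne'
  have := M.n_cast_pos.ne'
  field_simp

theorem rate_pos (M : Model μ X Y ψ K₀ KX) : 0 < rate n p KX K₀ (lambdaMin μ X ψ) := by
  have h : 0 < rate n p KX K₀ (lambdaMin μ X ψ) ^ 2 := by
    rw [M.rate_sq]
    have h1 := M.one_le_leverage
    have h2 := M.half_le_log
    have h3 := M.n_cast_pos
    have h4 := respBound_pos K₀
    have : 0 < leverage μ X ψ KX := by linarith
    have : 0 < Real.log p := by linarith
    positivity
  exact lt_of_le_of_ne (Real.sqrt_nonneg _) fun h0 => by simp [← h0] at h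

theorem leverage_mul_log_le (M : Model μ X Y ψ K₀ KX) :
    leverage μ X ψ KX / n * Real.log p ≤ rate n p KX K₀ (lambdaMin μ X ψ) ^ 2 := by
  rw [M.rate_sq, mul_assoc]
  have h1 : 0 ≤ leverage μ X ψ KX / n * Real.log p :=
    mul_nonneg (div_nonneg (leverage_nonneg X ψ KX) M.n_cast_pos.le) (by linarith [M.half_le_log])
  have h2 : 1 ≤ respBound K₀ / 2 := by
    rw [respBound]; linarith [sq_nonneg (K₀ : ℝ)]
  exact le_mul_of_one_le_left h1 h2

/-- As `6/7 ≤ e^{-1/7}`, the first `7 log p` factors cancel the dimension `p`; the remaining `b`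
factors are the probability. -/
theorem card_mul_pow_le (M : Model μ X Y ψ K₀ KX) (b : ℕ) :
    (p : ℝ) * (6 / 7) ^ (⌈7 * Real.log p⌉₊ + b) ≤ (6 / 7) ^ b := by
  have hp := M.p_cast_pos
  have h1 : (6 / 7 : ℝ) ≤ Real.exp (-(1 / 7)) := by
    have := Real.add_one_le_exp (-(1 / 7) : ℝ); linarith
  have h2 : (6 / 7 : ℝ) ^ ⌈7 * Real.log p⌉₊ ≤ (p : ℝ)⁻¹ := by
    refine (pow_le_pow_left₀ (by norm_num) h1 _).trans ?_
    rw [← Real.exp_nat_mul, ← Real.exp_log (inv_pos.2 hp), Real.log_inv]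
    refine Real.exp_le_exp.2 ?_
    linarith [Nat.le_ceil (7 * Real.log p)]
  rw [pow_add, ← mul_assoc]
  refine mul_le_of_le_one_left (by positivity) ?_
  calc (p : ℝ) * (6 / 7) ^ ⌈7 * Real.log p⌉₊ ≤ p * (p : ℝ)⁻¹ :=
        mul_le_mul_of_nonneg_left h2 hp.le
    _ = 1 := mul_inv_cancel₀ hp.ne'

theorem measure_not_isometry_le (M : Model μ X Y ψ K₀ KX) (b : ℕ)
    (hb : (2 * b + 11) * rate n p KX K₀ (lambdaMin μ X ψ) ^ 2 ≤ 1 / 4) :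
    μ {ω | ∃ β : Fin p → ℝ, empNormSq (fun i ω => linFun ψ β (X i ω)) ω <
        1 / 2 * theoNormSq μ fun i ω => linFun ψ β (X i ω)}
      ≤ ENNReal.ofReal ((6 / 7) ^ b) := by
  refine (M.measure_exists_empNormSq_lt (⌈7 * Real.log p⌉₊ + b) ?_).trans
    (ENNReal.ofReal_le_ofReal (M.card_mul_pow_le b))
  refine le_trans ?_ hb
  have hlog := M.half_le_log
  have hr : 0 ≤ leverage μ X ψ KX / n :=
    div_nonneg (leverage_nonneg X ψ KX) M.n_cast_pos.le
  -- The left side is at most `7 log p + b + 2`, and `1 ≤ 2 log p` turns `b + 2` into `(2 b + 4) log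
  -- p`.
  have h1 : (((⌈7 * Real.log p⌉₊ + b : ℕ) : ℝ) + 1) ≤ (2 * b + 11) * Real.log p := by
    push_cast
    have h2 := (Nat.ceil_lt_add_one (a := 7 * Real.log p) (by linarith)).le
    have h3 : (b : ℝ) * (1 / 2) ≤ b * Real.log p :=
      mul_le_mul_of_nonneg_left hlog (Nat.cast_nonneg _)
    linarith
  calc _ ≤ (2 * b + 11) * Real.log p * (leverage μ X ψ KX / n) :=
        mul_le_mul_of_nonneg_right h1 hr
    _ = (2 * b + 11) * (leverage μ X ψ KX / n * Real.log p) := by ring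
    _ ≤ _ := mul_le_mul_of_nonneg_left M.leverage_mul_log_le (by positivity)

theorem measure_score_ge_le (M : Model μ X Y ψ K₀ KX) {βs : Fin p → ℝ}
    (h : IsProjection μ X Y ψ (linFun ψ βs)) {c : ℝ} (hc : 0 < c) :
    μ {ω | c * rate n p KX K₀ (lambdaMin μ X ψ) ^ 2 ≤
        score X Y ψ βs ω ⬝ᵥ score X Y ψ βs ω / lambdaMin μ X ψ ^ 2}
      ≤ ENNReal.ofReal (4 / c) := by
  obtain ⟨i1, i2⟩ := M.score_dotProduct_integral h
  have hΛ := M.lambdaMin_pos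
  have hn := M.n_cast_pos
  have hδ := pow_pos M.rate_pos 2
  have hlog := M.half_le_log
  have hL : 0 < leverage μ X ψ KX := one_pos.trans_le M.one_le_leverage
  have hT := respBound_pos K₀
  refine (measure_ge_le_of_integral_le (i1.div_const _)
    (fun ω => div_nonneg (Finset.sum_nonneg fun _ _ => mul_self_nonneg _) (sq_nonneg _))
    (b := respBound K₀ * (leverage μ X ψ KX / n)) ?_ (by positivity)).trans
    (ENNReal.ofReal_le_ofReal ?_)
  · rw [integral_div, div_le_iff₀ (by positivity)]
    refine i2.trans (le_of_eq ?_)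
    rw [leverage]; field_simp
  · rw [M.rate_sq, div_le_div_iff₀ (by positivity) hc]
    have h1 : 0 ≤ respBound K₀ * (leverage μ X ψ KX / n) * c := by positivity
    nlinarith [mul_le_mul_of_nonneg_left hlog h1]

theorem measure_fluctuation_ge_le (M : Model μ X Y ψ K₀ KX) {βs : Fin p → ℝ}
    (h : IsProjection μ X Y ψ (linFun ψ βs)) {c : ℝ} (hc : 0 < c) :
    μ {ω | c * rate n p KX K₀ (lambdaMin μ X ψ) ^ 2 ≤
        (empNormSq (fun i ω => Y i ω - linFun ψ βs (X i ω)) ω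
          - theoNormSq μ fun i ω => Y i ω - linFun ψ βs (X i ω)) ^ 2}
      ≤ ENNReal.ofReal (96 * respBound K₀ / c) := by
  obtain ⟨i1, i2⟩ := M.empNormSq_resid_sub_integral h
  have hn := M.n_cast_pos
  have hδ := pow_pos M.rate_pos 2
  have hlog := M.half_le_log
  have hL : 0 < leverage μ X ψ KX := one_pos.trans_le M.one_le_leverage
  have hT := respBound_pos K₀
  refine (measure_ge_le_of_integral_le i1 (fun ω => sq_nonneg _) i2 (by positivity)).trans
    (ENNReal.ofReal_le_ofReal ?_)
  -- The second moment carries `respBound K₀ ^ 2` but `δ_n²` only its first power, so one factor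
  -- survives in the probability bound.
  rw [M.rate_sq, div_le_div_iff₀ (by positivity) hc, mul_div_assoc]
  have h1 : 0 ≤ respBound K₀ ^ 2 * (leverage μ X ψ KX / n) * c := by positivity
  nlinarith [mul_le_mul_of_nonneg_left hlog h1]

/-- Off three events of small probability, both error bounds hold. -/
theorem error_bounds (M : Model μ X Y ψ K₀ KX) {ω : Ω} {fhat : 𝒳 → ℝ} {βs : Fin p → ℝ}
    (hfit : IsLeastSquaresFit X Y ψ ω fhat) {c : ℝ}
    (hiso : ¬ ∃ β : Fin p → ℝ, empNormSq (fun i ω => linFun ψ β (X i ω)) ω <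
        1 / 2 * theoNormSq μ fun i ω => linFun ψ β (X i ω))
    (hscore : ¬ c * rate n p KX K₀ (lambdaMin μ X ψ) ^ 2 ≤
        score X Y ψ βs ω ⬝ᵥ score X Y ψ βs ω / lambdaMin μ X ψ ^ 2) :
    theoNorm μ X (fhat - linFun ψ βs) ≤ 2 * √c * rate n p KX K₀ (lambdaMin μ X ψ) ∧
    |empNormSq (fun i ω => Y i ω - fhat (X i ω)) ω
      - empNormSq (fun i ω => Y i ω - linFun ψ βs (X i ω)) ω|
      ≤ 2 * c * rate n p KX K₀ (lambdaMin μ X ψ) ^ 2 := by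
  obtain ⟨βh, rfl⟩ := hfit.1
  push Not at hiso hscore
  obtain ⟨h1, h2⟩ := M.fit_bounds (βs := βs) hfit (hiso _)
  have hδ := M.rate_pos
  constructor
  · have hc : 0 ≤ c := by
      by_contra! hneg
      have hV : 0 ≤ score X Y ψ βs ω ⬝ᵥ score X Y ψ βs ω / lambdaMin μ X ψ ^ 2 :=
        div_nonneg (Finset.sum_nonneg fun _ _ => mul_self_nonneg _) (sq_nonneg _)
      have := mul_neg_of_neg_of_pos hneg (pow_pos hδ 2)
      linarith
    rw [linFun_sub, theoNorm]
    refine Real.sqrt_le_iff.2 ⟨by positivity, ?_⟩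
    rw [mul_pow, mul_pow, Real.sq_sqrt hc]
    linarith
  · linarith

end Model

end Rate

end LeastSquares

/-! ### The asymptotic statement. -/

theorem mainTheorem5
    {Ω : ℕ → Type*} [∀ n, MeasurableSpace (Ω n)]
    (μ : ∀ n, Measure (Ω n)) [∀ n, IsProbabilityMeasure (μ n)]
    {𝒳 : ℕ → Type*} [∀ n, MeasurableSpace (𝒳 n)]
    (X : ∀ n, Fin n → Ω n → 𝒳 n) (Y : ∀ n, Fin n → Ω n → ℝ)
    (hX : ∀ n i, Measurable (X n i)) (hY : ∀ n i, Measurable (Y n i))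
    (hindep : ∀ n, iIndepFun (fun i ω => (X n i ω, Y n i ω)) (μ n))
    (p : ℕ → ℕ) (hp : ∀ n, 1 ≤ n → 2 ≤ p n)
    (ψ : ∀ n, Fin (p n) → 𝒳 n → ℝ) (hψ : ∀ n j, Measurable (ψ n j))
    (K₀ : ℕ → ℝ≥0)
    (hsub : ∀ n, 1 ≤ n → LeastSquares.UniformlySubGaussian (μ n) (Y n) (K₀ n))
    (KX : ℕ → ℝ)
    (hbdd : ∀ n, 1 ≤ n → ∀ᵐ ω ∂(μ n), ∀ i j, |ψ n j (X n i ω)| ≤ KX n)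
    (hΛ : ∀ n, 1 ≤ n → 0 < LeastSquares.lambdaMin (μ n) (X n) (ψ n))
    (δ : ℕ → ℝ)
    (hδ : ∀ n, δ n =
      LeastSquares.rate n (p n) (KX n) (K₀ n) (LeastSquares.lambdaMin (μ n) (X n) (ψ n)))
    (hδ0 : Tendsto δ atTop (𝓝 0))
    (fhat : ∀ n, Ω n → 𝒳 n → ℝ)
    (hfhat : ∀ n, 1 ≤ n → ∀ᵐ ω ∂(μ n),
      LeastSquares.IsLeastSquaresFit (X n) (Y n) (ψ n) ω (fhat n ω))
    (fstar : ∀ n, 𝒳 n → ℝ)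
    (hfstar : ∀ n, 1 ≤ n → LeastSquares.IsProjection (μ n) (X n) (Y n) (ψ n) (fstar n)) :
    LeastSquares.IsBigOP μ
      (fun n ω => LeastSquares.theoNorm (μ n) (X n) (fhat n ω - fstar n)) δ ∧
    (BddAbove (Set.range K₀) →
      LeastSquares.IsBigOP μ
        (fun n ω =>
          |LeastSquares.empNormSq (fun i ω' => Y n i ω' - fhat n ω (X n i ω')) ω -
            LeastSquares.theoNormSq (μ n) (fun i ω' => Y n i ω' - fstar n (X n i ω'))|) δ) := by
  have model : ∀ n, 1 ≤ n → LeastSquares.Model (μ n) (X n) (Y n) (ψ n) (K₀ n) (KX n) :=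
    fun n hn => ⟨hX n, hY n, hψ n, hindep n, hsub n hn, hbdd n hn, hΛ n hn, hn, hp n hn⟩
  have hδ2 : Tendsto (fun n => δ n ^ 2) atTop (𝓝 0) := by simpa using hδ0.pow 2
  have isometry : ∀ ε : ℝ, 0 < ε → ∀ᶠ n in atTop,
      μ n {ω | ∃ β : Fin (p n) → ℝ,
        LeastSquares.empNormSq (fun i ω => LeastSquares.linFun (ψ n) β (X n i ω)) ω <
        1 / 2 * LeastSquares.theoNormSq (μ n) fun i ω => LeastSquares.linFun (ψ n) β (X n i ω)}
      ≤ ENNReal.ofReal ε := by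
    intro ε hε
    obtain ⟨b, hb⟩ := exists_pow_lt_of_lt_one hε (show (6 / 7 : ℝ) < 1 by norm_num)
    have hlim : Tendsto (fun n => (2 * b + 11 : ℝ) * δ n ^ 2) atTop (𝓝 0) := by
      simpa using hδ2.const_mul (2 * b + 11 : ℝ)
    filter_upwards [eventually_ge_atTop 1, hlim.eventually_le_const (show (0 : ℝ) < 1 / 4 by
      norm_num)] with n hn hδn
    rw [hδ n] at hδn
    exact ((model n hn).measure_not_isometry_le b hδn).trans
      (ENNReal.ofReal_le_ofReal hb.le)
  constructor
  · intro ε hε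
    -- Chosen so that the score event has probability at most `4 / c = ε / 2`.
    have hc : 0 < 8 / ε := by positivity
    refine ⟨2 * √(8 / ε), by positivity, ?_⟩
    filter_upwards [eventually_ge_atTop 1, isometry (ε / 2) (by positivity)] with n hn hiso
    have M := model n hn
    obtain ⟨βs, hβs⟩ := (hfstar n hn).1
    have hproj := hfstar n hn
    rw [← hβs] at hproj
    have hscore := M.measure_score_ge_le hproj hc
    refine (measure_mono_ae ?_).trans ((measure_union_le _ _).trans
      ((add_le_add hiso hscore).trans (le_of_eq ?_)))
    · filter_upwards [hfhat n hn] with ω hfit hω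
      by_contra hcon
      obtain ⟨h1, h2⟩ := not_or.1 hcon
      have h3 := (M.error_bounds hfit h1 h2).1
      have h4 : 2 * √(8 / ε) * δ n
          < |LeastSquares.theoNorm (μ n) (X n) (fhat n ω - fstar n)| := hω
      rw [abs_of_nonneg (show 0 ≤ LeastSquares.theoNorm (μ n) (X n) (fhat n ω - fstar n) from
        Real.sqrt_nonneg _), hδ n, ← hβs] at h4
      exact absurd h3 (not_le.2 h4)
    · rw [← ENNReal.ofReal_add (by positivity) (by positivity)]
      congr 1
      field_simp
      norm_num
  · rintro ⟨K, hK⟩ ε hε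
    have hT := LeastSquares.Model.respBound_pos K
    -- The budget is split in three: `4 / c = ε / 3` for the score, and `c'` makes `96 T / c' = ε /
    -- 3` for the fluctuation, where `T` is the bound uniform in `n`.
    have hc : 0 < 12 / ε := by positivity
    have hc' : 0 < 288 * LeastSquares.Model.respBound K / ε := by positivity
    refine ⟨2 * (12 / ε) + √(288 * LeastSquares.Model.respBound K / ε), by positivity, ?_⟩
    filter_upwards [eventually_ge_atTop 1, isometry (ε / 3) (by positivity),
      hδ0.eventually_le_const one_pos] with n hn hiso hδ1
    have M := model n hn
    obtain ⟨βs, hβs⟩ := (hfstar n hn).1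
    have hproj := hfstar n hn
    rw [← hβs] at hproj
    have hscore := M.measure_score_ge_le hproj hc
    have hfluc := M.measure_fluctuation_ge_le hproj hc'
    have hKn : (K₀ n : ℝ) ≤ K := NNReal.coe_le_coe.2 (hK ⟨n, rfl⟩)
    have hTn : LeastSquares.Model.respBound (K₀ n) ≤ LeastSquares.Model.respBound K := by
      unfold LeastSquares.Model.respBound; gcongr
    have hfluc' := hfluc.trans (ENNReal.ofReal_le_ofReal (show _ ≤ ε / 3 by
      rw [div_le_iff₀ hc']
      have : ε / 3 * (288 * LeastSquares.Model.respBound K / ε)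
        = 96 * LeastSquares.Model.respBound K := by field_simp; norm_num
      linarith))
    refine (measure_mono_ae ?_).trans ((measure_union_le _ _).trans
      ((add_le_add ((measure_union_le _ _).trans (add_le_add hiso hscore)) hfluc').trans
        (le_of_eq ?_)))
    · filter_upwards [hfhat n hn] with ω hfit hω
      by_contra hcon
      obtain ⟨h12, h3⟩ := not_or.1 hcon
      obtain ⟨h1, h2⟩ := not_or.1 h12
      have h4 := (M.error_bounds hfit h1 h2).2
      have h5 := h3
      rw [Set.mem_ofPred_eq, not_le] at h5
      have hδn : 0 < δ n := by rw [hδ n]; exact M.rate_pos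
      rw [← hδ n] at h4 h5
      have h6 := Real.abs_le_sqrt h5.le
      rw [Real.sqrt_mul hc'.le, Real.sqrt_sq hδn.le] at h6
      -- The empirical risks of `f̂` and `f*` differ by order `δ_n²`, which is at most `δ_n` once
      -- `δ_n ≤ 1`.
      have h7 : 2 * (12 / ε) * δ n ^ 2 ≤ 2 * (12 / ε) * δ n :=
        mul_le_mul_of_nonneg_left (by nlinarith) (by positivity)
      have h8 : (2 * (12 / ε) + √(288 * LeastSquares.Model.respBound K / ε)) * δ n
          < |(|LeastSquares.empNormSq (fun i ω' => Y n i ω' - fhat n ω (X n i ω')) ω -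
            LeastSquares.theoNormSq (μ n) (fun i ω' => Y n i ω' - fstar n (X n i ω'))|)| := hω
      rw [abs_abs, ← hβs] at h8
      have h9 := abs_sub_le
        (LeastSquares.empNormSq (fun i ω' => Y n i ω' - fhat n ω (X n i ω')) ω)
        (LeastSquares.empNormSq
          (fun i ω' => Y n i ω' - LeastSquares.linFun (ψ n) βs (X n i ω')) ω)
        (LeastSquares.theoNormSq (μ n)
          (fun i ω' => Y n i ω' - LeastSquares.linFun (ψ n) βs (X n i ω')))
      linarith
    · rw [← ENNReal.ofReal_add (by positivity) (by positivity),
        ← ENNReal.ofReal_add (by positivity) (by positivity)]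
      congr 1
      field_simp
      norm_num
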